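/- **Setting.** Let $\mathcal V$ be a uniformly discrete subset of the $xy$-plane in $\mathbb R^3$ and $\mathcal E\subset\mathcal V\times\mathcal V$ a set of directed edges $\alpha\beta$ (from $\alpha$ to $\beta$), of length $l_{\alpha\beta}=|\beta-\alpha|$ and direction $e_{\alpha\beta}=(\beta-\alpha)/l_{\alpha\beta}$, such that $0<\inf l_{\alpha\beta}\le\sup l_{\alpha\beta}<\infty$ and, for some $N$, every vertex has total degree (in plus out) between $1$ and $N$. Identify $\alpha\beta$ with $[0,l_{\alpha\beta}]$. Let $U_{\alpha\beta}\in L^2[0,l_{\alpha\beta}]$ be real with $\sup\|U_{\alpha\beta}\|_{L^2}<\infty$, let $A\in C^1(\mathbb R^3,\mathbb R^3)$, $k_R\in\mathbb R$ and $\epsilon:\mathcal V\to\mathbb R$. Put $$a_{\alpha\beta}(t)=\langle A(\alpha+te_{\alpha\beta}),e_{\alpha\beta}\rangle,\quad \sigma_{\alpha\beta}=\begin{pmatrix}0&e_{\alpha\beta,2}+\mathrm i e_{\alpha\beta,1}\\ e_{\alpha\beta,2}-\mathrm i e_{\alpha\beta,1}&0\end{pmatrix},$$ $$L_{\alpha\beta}=\Big(\mathrm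 i\frac{d}{dt}+a_{\alpha\beta}+k_R\sigma_{\alpha\beta}\Big)^2+U_{\alpha\beta}-k_R^2,$$ $$\Theta_{\alpha\beta}(t)=\exp\Big(\mathrm i\int_0^t(a_{\alpha\beta}(r)+k_R\sigma_{\alpha\beta})\,dr\Big),\qquad \tau_{\alpha\beta}=\Theta_{\alpha\beta}(l_{\alpha\beta}).$$ Let $\mathcal H=\bigoplus_{\alpha\beta\in\mathcal E}L^2([0,l_{\alpha\beta}],\mathbb C^2)$. Let $D$ be the operator $(f_{\alpha\beta})\mapsto(L_{\alpha\beta}f_{\alpha\beta})$ in $\mathcal H$ whose domain consists of the $f\in\mathcal H$ with $f_{\alpha\beta}\in H^2$, $f_{\alpha\beta}(0)=f_{\alpha\beta}(l_{\alpha\beta})=0$ for every edge and $(L_{\alpha\beta}f_{\alpha\beta})\in\mathcal H$. Let $L$ be the operator acting by the same rule on the $f\in\mathcal H$ with $f_{\alpha\beta}\in H^2$, $(L_{\alpha\beta}f_{\alpha\beta})\in\mathcal H$, that are continuous at all vertices, i.e. there are values $f(\alpha)$ with $f_{\alpha\beta}(0)=f(\alpha)$ and $f_{\alpha\beta}(l_{\alpha\beta})=f(\beta)$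 for all edges $\alpha\beta$, and satisfy at every vertex $\alpha$ the condition $$\sum_{\alpha\beta\in\mathcal E}\Big[\frac{d}{dt}-\mathrm i(a_{\alpha\beta}+k_R\sigma_{\alpha\beta})\Big]f_{\alpha\beta}(0)-\sum_{\beta\alpha\in\mathcal E}\Big[\frac{d}{dt}-\mathrm i(a_{\beta\alpha}+k_R\sigma_{\beta\alpha})\Big]f_{\beta\alpha}(l_{\beta\alpha})=\epsilon(\alpha)f(\alpha).\tag{1}$$ For $z\in\mathbb C$ let $s_{\alpha\beta}(\cdot;z)$ and $c_{\alpha\beta}(\cdot;z)$ be the solutions of $-y''+U_{\alpha\beta}y=zy$ on $[0,l_{\alpha\beta}]$ with $s(0)=c'(0)=0$, $s'(0)=c(0)=1$. A *continuous solution of $(L-E)f=0$* is a family $f=(f_{\alpha\beta})$ with $f_{\alpha\beta}\in H^2([0,l_{\alpha\beta}],\mathbb C^2)$ and $L_{\alpha\beta}f_{\alpha\beta}=Ef_{\alpha\beta}$ a.e. on each edge which is continuous at all vertices; neither $f\in\mathcal H$ nor (1) is required. **Theorem.** Let $E\in\mathbb C\setminus\operatorname{spec}D$ and $z=E+k_R^2$.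 Then $s_{\alpha\beta}(l_{\alpha\beta};z)\ne0$ for every edge, and every continuous solution $f$ of $(L-E)f=0$ has the following properties. 1. For every edge $\alpha\beta$ and $t\in[0,l_{\alpha\beta}]$, $$f_{\alpha\beta}(t)=\frac{s_{\alpha\beta}(t;z)}{s_{\alpha\beta}(l_{\alpha\beta};z)}\,\Theta_{\alpha\beta}(t)\big[\tau_{\alpha\beta}^*f(\beta)-c_{\alpha\beta}(l_{\alpha\beta};z)f(\alpha)\big]+\Theta_{\alpha\beta}(t)\,c_{\alpha\beta}(t;z)\,f(\alpha).$$ 2. For every vertex $\alpha$, condition (1) holds at $\alpha$ if and only if $$\sum_{\alpha\beta\in\mathcal E}\frac{\tau_{\alpha\beta}^*f(\beta)}{s_{\alpha\beta}(l_{\alpha\beta};z)}+\sum_{\beta\alpha\in\mathcal E}\frac{\tau_{\beta\alpha}f(\beta)}{s_{\beta\alpha}(l_{\beta\alpha};z)}=\Big[\sum_{\alpha\beta\in\mathcal E}\frac{c_{\alpha\beta}(l_{\alpha\beta};z)}{s_{\alpha\beta}(l_{\alpha\beta};z)}+\sum_{\beta\alpha\in\mathcal E}\frac{s_{\beta\alpha}'(l_{\beta\alpha};z)}{s_{\beta\alpha}(l_{\beta\alpha};z)}+\epsilon(\alpha)\Big]f(\alpha).$$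 3. $f\in\mathcal H$ if and only if $(f(\alpha))_{\alpha\in\mathcal V}\in\ell^2(\mathcal V,\mathbb C^2)$. In particular, if $f$ is not identically zero and satisfies (1) at every vertex, then $f$ is an eigenfunction of $L$ with eigenvalue $E$ if and only if $(f(\alpha))_{\alpha\in\mathcal V}\in\ell^2(\mathcal V,\mathbb C^2)$. -/

import Mathlib

open MeasureTheory Set
open scoped ENNReal

noncomputable section

/-- The ambient space `ℝ³`. -/
abbrev Space3 : Type := EuclideanSpace ℝ (Fin 3)

/-- The spinor space `ℂ²`. -/
abbrev Spinor : Type := EuclideanSpace ℂ (Fin 2)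

/-- The derivative of a function on the segment `[0, l]` (one-sided at the ends). -/
def segDeriv {F : Type*} [NormedAddCommGroup F] [NormedSpace ℝ F] (l : ℝ) (f : ℝ → F) : ℝ → F :=
  fun t => derivWithin f (Icc 0 l) t

/-- `f` (restricted to `[0, l]`) is an element of the Sobolev space `H²([0, l], F)`, given by its
continuously differentiable representative: `f` is differentiable on `[0, l]`, and its derivative is
absolutely continuous with (a.e.) derivative `g ∈ L²`. -/
structure MemH2 {F : Type*} [NormedAddCommGroup F] [NormedSpace ℝ F] (l : ℝ) (f : ℝ → F) :
    Prop where
  differentiableOn : DifferentiableOn ℝ f (Icc 0 l)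
  exists_second : ∃ g : ℝ → F, MemLp g 2 (volume.restrict (Icc 0 l)) ∧
    ∀ t ∈ Icc 0 l, segDeriv l f t = segDeriv l f 0 + ∫ s in (0 : ℝ)..t, g s

/-- The data and the standing assumptions: a metric graph with straight edges in the `xy`-plane of
`ℝ³`, scalar potentials on the edges, a magnetic vector potential, a Rashba constant and coupling
constants at the vertices. A pair `(α, β) ∈ edges` is the directed edge from `α` to `β`. -/
structure RashbaNetwork where
  vertices : Set Space3
  planar : ∀ α ∈ vertices, α 2 = 0
  uniformly_discrete : ∃ d : ℝ, 0 < d ∧ ∀ α ∈ vertices, ∀ β ∈ vertices, α ≠ β → d ≤ dist α β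
  edges : Set (Space3 × Space3)
  edges_subset : edges ⊆ vertices ×ˢ vertices
  degree_bounds : ∃ N : ℕ, ∀ α ∈ vertices,
    1 ≤ {e ∈ edges | e.1 = α}.encard + {e ∈ edges | e.2 = α}.encard ∧
    {e ∈ edges | e.1 = α}.encard + {e ∈ edges | e.2 = α}.encard ≤ N
  length_bounds : ∃ a b : ℝ, 0 < a ∧ ∀ e ∈ edges, a ≤ dist e.1 e.2 ∧ dist e.1 e.2 ≤ b
  /-- scalar potentials on the edges -/
  U : edges → ℝ → ℝ
  memLp_U : ∀ e : edges, MemLp (U e) 2 (volume.restrict (Icc 0 (dist e.1.1 e.1.2)))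
  bounded_U : ∃ C : ℝ, ∀ e : edges,
    eLpNorm (U e) 2 (volume.restrict (Icc 0 (dist e.1.1 e.1.2))) ≤ ENNReal.ofReal C
  /-- magnetic vector potential -/
  A : Space3 → Space3
  contDiff_A : ContDiff ℝ 1 A
  /-- Rashba constant -/
  kR : ℝ
  /-- coupling constants -/
  ε : vertices → ℝ

namespace RashbaNetwork

abbrev Vertex (Q : RashbaNetwork) : Type := Q.vertices

abbrev Edge (Q : RashbaNetwork) : Type := Q.edges

/-- initial vertex -/
def src (Q : RashbaNetwork) (e : Q.Edge) : Q.Vertex := ⟨e.1.1, (Q.edges_subset e.2).1⟩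

/-- terminal vertex -/
def tgt (Q : RashbaNetwork) (e : Q.Edge) : Q.Vertex := ⟨e.1.2, (Q.edges_subset e.2).2⟩

/-- the set of edges starting at `α` -/
def outEdges (Q : RashbaNetwork) (α : Q.Vertex) : Set Q.Edge := {e | Q.src e = α}

/-- the set of edges ending at `α` -/
def inEdges (Q : RashbaNetwork) (α : Q.Vertex) : Set Q.Edge := {e | Q.tgt e = α}

/-- length of an edge -/
def len (Q : RashbaNetwork) (e : Q.Edge) : ℝ := dist e.1.1 e.1.2

/-- unit direction vector of an edge -/
def dir (Q : RashbaNetwork) (e : Q.Edge) : Space3 := (Q.len e)⁻¹ • (e.1.2 - e.1.1)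

/-- Lebesgue measure on the segment `[0, l]` of an edge of length `l` -/
def edgeMeasure (Q : RashbaNetwork) (e : Q.Edge) : Measure ℝ := volume.restrict (Icc 0 (Q.len e))

/-- magnetic potential along an edge -/
def a (Q : RashbaNetwork) (e : Q.Edge) (t : ℝ) : ℝ := inner ℝ (Q.A (e.1.1 + t • Q.dir e)) (Q.dir e)

/-- the spin matrix `σ` of an edge, as an operator in `ℂ²` -/
def σ (Q : RashbaNetwork) (e : Q.Edge) : Spinor →L[ℂ] Spinor :=
  Matrix.toEuclideanCLM (𝕜 := ℂ) (n := Fin 2)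
    !![0, (Q.dir e 1 : ℂ) + Complex.I * (Q.dir e 0 : ℂ);
       (Q.dir e 1 : ℂ) - Complex.I * (Q.dir e 0 : ℂ), 0]

/-- the total gauge potential `a(t) + k_R σ` of an edge -/
def gauge (Q : RashbaNetwork) (e : Q.Edge) (t : ℝ) : Spinor →L[ℂ] Spinor :=
  (Q.a e t : ℂ) • (1 : Spinor →L[ℂ] Spinor) + (Q.kR : ℂ) • Q.σ e

/-- `Θ(t) = exp (i ∫₀ᵗ (a(s) + k_R σ) ds)` -/
def Θ (Q : RashbaNetwork) (e : Q.Edge) (t : ℝ) : Spinor →L[ℂ] Spinor :=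
  NormedSpace.exp (Complex.I • ∫ s in (0 : ℝ)..t, Q.gauge e s)

/-- `τ = Θ(l)`, where `l` is the length of the edge -/
def τ (Q : RashbaNetwork) (e : Q.Edge) : Spinor →L[ℂ] Spinor := Q.Θ e (Q.len e)

/-- the operation `(i d/dt + a + k_R σ) f` on an edge -/
def momentum (Q : RashbaNetwork) (e : Q.Edge) (f : ℝ → Spinor) : ℝ → Spinor :=
  fun t => Complex.I • segDeriv (Q.len e) f t + Q.gauge e t (f t)

/-- the differential expression `((i d/dt + a + k_R σ)² + U - k_R²) f` on an edge -/
def edgeOp (Q : RashbaNetwork) (e : Q.Edge) (f : ℝ → Spinor) : ℝ → Spinor :=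
  fun t => Q.momentum e (Q.momentum e f) t + ((Q.U e t - Q.kR ^ 2 : ℝ) : ℂ) • f t

/-- the covariant derivative `(d/dt - i (a + k_R σ)) f` on an edge -/
def covDeriv (Q : RashbaNetwork) (e : Q.Edge) (f : ℝ → Spinor) : ℝ → Spinor :=
  fun t => segDeriv (Q.len e) f t - Complex.I • Q.gauge e t (f t)

/-- The family `f` is continuous at all vertices, with value `ξ α` at the vertex `α`. -/
def HasVertexValues (Q : RashbaNetwork) (f : Q.Edge → ℝ → Spinor) (ξ : Q.Vertex → Spinor) : Prop :=
  ∀ e, f e 0 = ξ (Q.src e) ∧ f e (Q.len e) = ξ (Q.tgt e)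

/-- the sum of the outgoing covariant derivatives at a vertex -/
def flux (Q : RashbaNetwork) (f : Q.Edge → ℝ → Spinor) (α : Q.Vertex) : Spinor :=
  (∑ᶠ e ∈ Q.outEdges α, Q.covDeriv e (f e) 0) -
    ∑ᶠ e ∈ Q.inEdges α, Q.covDeriv e (f e) (Q.len e)

/-- A continuous solution of `(L - E) f = 0` with vertex values `ξ`: each component is in `H²` of its
edge and satisfies the differential equation there (almost everywhere), and `f` is continuous at all
vertices. No integrability over the whole graph is required. -/
structure IsContinuousSolution (Q : RashbaNetwork) (E : ℂ) (f : Q.Edge → ℝ → Spinor)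
    (ξ : Q.Vertex → Spinor) : Prop where
  memH2 : ∀ e, MemH2 (Q.len e) (f e)
  vertexValues : Q.HasVertexValues f ξ
  equation : ∀ e, ∀ᵐ t ∂(Q.edgeMeasure e), Q.edgeOp e (f e) t = E • f e t

/-- `y ∈ H²[0, l]` solves `-y'' + U y = z y` on the edge (almost everywhere). -/
def IsScalarSolution (Q : RashbaNetwork) (e : Q.Edge) (z : ℂ) (y : ℝ → ℂ) : Prop :=
  MemH2 (Q.len e) y ∧ ∀ᵐ t ∂(Q.edgeMeasure e),
    -segDeriv (Q.len e) (segDeriv (Q.len e) y) t + (Q.U e t : ℂ) * y t = z * y t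

/-- `y` is the solution of `-y'' + U y = z y` with `y(0) = 0`, `y'(0) = 1`. -/
def IsSineSolution (Q : RashbaNetwork) (e : Q.Edge) (z : ℂ) (y : ℝ → ℂ) : Prop :=
  Q.IsScalarSolution e z y ∧ y 0 = 0 ∧ segDeriv (Q.len e) y 0 = 1

/-- `y` is the solution of `-y'' + U y = z y` with `y(0) = 1`, `y'(0) = 0`. -/
def IsCosineSolution (Q : RashbaNetwork) (e : Q.Edge) (z : ℂ) (y : ℝ → ℂ) : Prop :=
  Q.IsScalarSolution e z y ∧ y 0 = 1 ∧ segDeriv (Q.len e) y 0 = 0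

/-- the solution `s(·; z)` on an edge -/
def s (Q : RashbaNetwork) (e : Q.Edge) (z : ℂ) : ℝ → ℂ := Classical.epsilon (Q.IsSineSolution e z)

/-- the solution `c(·; z)` on an edge -/
def c (Q : RashbaNetwork) (e : Q.Edge) (z : ℂ) : ℝ → ℂ := Classical.epsilon (Q.IsCosineSolution e z)

/-- the derivative `s'(·; z)` on an edge -/
def s' (Q : RashbaNetwork) (e : Q.Edge) (z : ℂ) : ℝ → ℂ := segDeriv (Q.len e) (Q.s e z)

/-- The state space: the Hilbert direct sum of `L²([0, l], ℂ²)` over all edges. -/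
abbrev StateSpace (Q : RashbaNetwork) : Type :=
  lp (fun e : Q.Edge => Lp Spinor 2 (Q.edgeMeasure e)) 2

/-- The family of functions `f` represents the state `u`. -/
def Represents (Q : RashbaNetwork) (f : Q.Edge → ℝ → Spinor) (u : Q.StateSpace) : Prop :=
  ∀ e, (u e : ℝ → Spinor) =ᵐ[Q.edgeMeasure e] f e

/-- `f` belongs to the state space `L²` of the graph. -/
def SquareIntegrable (Q : RashbaNetwork) (f : Q.Edge → ℝ → Spinor) : Prop :=
  ∃ u : Q.StateSpace, Q.Represents f u

lemma len_pos (Q : RashbaNetwork) (e : Q.Edge) : 0 < Q.len e := by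
  obtain ⟨a, b, ha, h⟩ := Q.length_bounds
  exact ha.trans_le (h e.1 e.2).1

lemma finite_outEdges (Q : RashbaNetwork) (α : Q.Vertex) : (Q.outEdges α).Finite := by
  obtain ⟨N, h⟩ := Q.degree_bounds
  have h1 : {e ∈ Q.edges | e.1 = α.1}.Finite := by
    refine Set.encard_lt_top_iff.1 (lt_of_le_of_lt (le_self_add.trans (h α.1 α.2).2) ?_)
    exact ENat.natCast_lt_top N
  refine Set.Finite.of_finite_image (f := Subtype.val) (h1.subset ?_) Subtype.val_injective.injOn
  rintro _ ⟨e, he, rfl⟩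
  exact ⟨e.2, congrArg Subtype.val he⟩

lemma finite_inEdges (Q : RashbaNetwork) (α : Q.Vertex) : (Q.inEdges α).Finite := by
  obtain ⟨N, h⟩ := Q.degree_bounds
  have h1 : {e ∈ Q.edges | e.2 = α.1}.Finite := by
    refine Set.encard_lt_top_iff.1 (lt_of_le_of_lt (le_add_self.trans (h α.1 α.2).2) ?_)
    exact ENat.natCast_lt_top N
  refine Set.Finite.of_finite_image (f := Subtype.val) (h1.subset ?_) Subtype.val_injective.injOn
  rintro _ ⟨e, he, rfl⟩
  exact ⟨e.2, congrArg Subtype.val he⟩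

end RashbaNetwork

section segment

variable {F : Type*} [NormedAddCommGroup F] [NormedSpace ℝ F] {l : ℝ}

lemma segDeriv_add {f g : ℝ → F} {t : ℝ} (hf : DifferentiableWithinAt ℝ f (Icc 0 l) t)
    (hg : DifferentiableWithinAt ℝ g (Icc 0 l) t) :
    segDeriv l (f + g) t = segDeriv l f t + segDeriv l g t := derivWithin_add hf hg

lemma segDeriv_smul [NormedSpace ℂ F] [IsScalarTower ℝ ℂ F] {f : ℝ → F} {t : ℝ} (k : ℂ)
    (hf : DifferentiableWithinAt ℝ f (Icc 0 l) t) :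
    segDeriv l (k • f) t = k • segDeriv l f t := derivWithin_const_smul k hf

lemma segDeriv_congr {f g : ℝ → F} (h : EqOn f g (Icc 0 l)) :
    EqOn (segDeriv l f) (segDeriv l g) (Icc 0 l) :=
  fun _ ht => derivWithin_congr h (h ht)

lemma intervalIntegrable_of_memLp {F : Type*} [NormedAddCommGroup F] {l : ℝ} {g : ℝ → F} (hg : MemLp g 2 (volume.restrict (Icc 0 l)))
    {t : ℝ} (ht : t ∈ Icc 0 l) : IntervalIntegrable g volume 0 t := by
  have h : IntegrableOn g (Icc 0 l) := hg.integrable (by norm_num)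
  rw [intervalIntegrable_iff, uIoc_of_le ht.1]
  exact h.mono_set fun x hx => ⟨hx.1.le, hx.2.trans ht.2⟩

lemma MemH2.add {f g : ℝ → F} (hf : MemH2 l f) (hg : MemH2 l g) : MemH2 l (f + g) := by
  refine ⟨hf.1.add hg.1, ?_⟩
  obtain ⟨f2, hf2, hf'⟩ := hf.2
  obtain ⟨g2, hg2, hg'⟩ := hg.2
  refine ⟨f2 + g2, hf2.add hg2, fun t ht => ?_⟩
  have h0 : (0 : ℝ) ∈ Icc 0 l := ⟨le_rfl, ht.1.trans ht.2⟩
  have hint : (∫ s in (0 : ℝ)..t, (f2 + g2) s) =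
      (∫ s in (0 : ℝ)..t, f2 s) + ∫ s in (0 : ℝ)..t, g2 s :=
    intervalIntegral.integral_add (intervalIntegrable_of_memLp hf2 ht)
      (intervalIntegrable_of_memLp hg2 ht)
  rw [segDeriv_add (hf.1 t ht) (hg.1 t ht), segDeriv_add (hf.1 0 h0) (hg.1 0 h0), hf' t ht,
    hg' t ht, hint]
  abel

lemma MemH2.smul [NormedSpace ℂ F] [IsScalarTower ℝ ℂ F] {f : ℝ → F} (k : ℂ) (hf : MemH2 l f) :
    MemH2 l (k • f) := by
  refine ⟨hf.1.const_smul k, ?_⟩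
  obtain ⟨f2, hf2, hf'⟩ := hf.2
  refine ⟨k • f2, hf2.const_smul k, fun t ht => ?_⟩
  have h0 : (0 : ℝ) ∈ Icc 0 l := ⟨le_rfl, ht.1.trans ht.2⟩
  rw [segDeriv_smul k (hf.1 t ht), segDeriv_smul k (hf.1 0 h0), hf' t ht, smul_add,
    ← intervalIntegral.integral_smul]
  rfl

lemma MemH2.zero : MemH2 l (0 : ℝ → F) := by
  have h : segDeriv l (0 : ℝ → F) = 0 := by
    funext t
    exact congrFun (derivWithin_const (s := Icc 0 l) (c := (0 : F))) t
  refine ⟨differentiableOn_const 0, 0, MemLp.zero, fun t _ => ?_⟩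
  simp [h]

lemma MemH2.ae_differentiable [CompleteSpace F] {f : ℝ → F} (hf : MemH2 l f) :
    ∀ᵐ t ∂(volume.restrict (Icc 0 l)), DifferentiableWithinAt ℝ (segDeriv l f) (Icc 0 l) t := by
  obtain ⟨g, hg, h⟩ := hf.2
  rw [ae_restrict_iff' measurableSet_Icc]
  rcases le_or_gt 0 l with hl | hl
  · have hi := intervalIntegrable_of_memLp hg (t := l) ⟨hl, le_rfl⟩
    filter_upwards [hi.ae_hasDerivAt_integral] with t ht hmem
    rw [uIcc_of_le hl] at ht
    have h1 := (ht hmem 0 ⟨le_rfl, hl⟩).differentiableAt.differentiableWithinAt (s := Icc 0 l)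
    exact (h1.const_add (segDeriv l f 0)).congr h (h t hmem)
  · refine Filter.Eventually.of_forall fun t ht => ?_
    exact absurd (ht.1.trans ht.2) (not_le.2 hl)

end segment

namespace RashbaNetwork

lemma differentiable_gauge_apply (Q : RashbaNetwork) (e : Q.Edge) {f : ℝ → Spinor} {t : ℝ}
    (hf : DifferentiableWithinAt ℝ f (Icc 0 (Q.len e)) t) :
    DifferentiableWithinAt ℝ (fun t => Q.gauge e t (f t)) (Icc 0 (Q.len e)) t := by
  have hA : Differentiable ℝ Q.A := Q.contDiff_A.differentiable one_ne_zero
  have ha : Differentiable ℝ (Q.a e) := by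
    have h : Differentiable ℝ fun t : ℝ => Q.A (e.1.1 + t • Q.dir e) :=
      hA.comp ((differentiable_const _).add (differentiable_id.smul_const _))
    exact h.inner ℝ (differentiable_const _)
  have ha' : DifferentiableWithinAt ℝ (fun t => ((Q.a e t : ℝ) : ℂ)) (Icc 0 (Q.len e)) t :=
    (Complex.ofRealCLM.differentiable.comp ha).differentiableAt.differentiableWithinAt
  have hσ : DifferentiableWithinAt ℝ (fun t => (Q.kR : ℂ) • Q.σ e (f t)) (Icc 0 (Q.len e)) t :=
    ((((Q.σ e).restrictScalars ℝ).differentiableAt).comp_differentiableWithinAt t hf).const_smul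
      (Q.kR : ℂ)
  exact (ha'.smul hf).add hσ

lemma momentum_add (Q : RashbaNetwork) (e : Q.Edge) {f g : ℝ → Spinor} {t : ℝ}
    (hf : DifferentiableWithinAt ℝ f (Icc 0 (Q.len e)) t)
    (hg : DifferentiableWithinAt ℝ g (Icc 0 (Q.len e)) t) :
    Q.momentum e (f + g) t = Q.momentum e f t + Q.momentum e g t := by
  simp only [momentum, segDeriv_add hf hg, Pi.add_apply, map_add, smul_add]
  abel

lemma momentum_smul (Q : RashbaNetwork) (e : Q.Edge) {f : ℝ → Spinor} {t : ℝ} (k : ℂ)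
    (hf : DifferentiableWithinAt ℝ f (Icc 0 (Q.len e)) t) :
    Q.momentum e (k • f) t = k • Q.momentum e f t := by
  simp only [momentum, segDeriv_smul k hf, Pi.smul_apply, map_smul, smul_add,
    smul_comm Complex.I k]

lemma momentum_congr (Q : RashbaNetwork) (e : Q.Edge) {f g : ℝ → Spinor}
    (h : EqOn f g (Icc 0 (Q.len e))) :
    EqOn (Q.momentum e f) (Q.momentum e g) (Icc 0 (Q.len e)) := fun t ht => by
  simp only [momentum, segDeriv_congr h ht, h ht]

lemma edgeOp_congr (Q : RashbaNetwork) (e : Q.Edge) {f g : ℝ → Spinor}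
    (h : EqOn f g (Icc 0 (Q.len e))) :
    EqOn (Q.edgeOp e f) (Q.edgeOp e g) (Icc 0 (Q.len e)) := fun t ht => by
  simp only [edgeOp, Q.momentum_congr e (Q.momentum_congr e h) ht, h ht]

lemma ae_differentiable_momentum (Q : RashbaNetwork) (e : Q.Edge) {f : ℝ → Spinor}
    (hf : MemH2 (Q.len e) f) : ∀ᵐ t ∂(Q.edgeMeasure e), t ∈ Icc 0 (Q.len e) ∧
      DifferentiableWithinAt ℝ (Q.momentum e f) (Icc 0 (Q.len e)) t := by
  filter_upwards [hf.ae_differentiable, ae_restrict_mem measurableSet_Icc] with t ht hmem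
  exact ⟨hmem, (ht.const_smul Complex.I).add (Q.differentiable_gauge_apply e (hf.1 t hmem))⟩

lemma edgeOp_add (Q : RashbaNetwork) (e : Q.Edge) {f g : ℝ → Spinor}
    (hf : MemH2 (Q.len e) f) (hg : MemH2 (Q.len e) g) :
    Q.edgeOp e (f + g) =ᵐ[Q.edgeMeasure e] Q.edgeOp e f + Q.edgeOp e g := by
  filter_upwards [Q.ae_differentiable_momentum e hf, Q.ae_differentiable_momentum e hg] with t h1 h2
  have h : EqOn (Q.momentum e (f + g)) (Q.momentum e f + Q.momentum e g) (Icc 0 (Q.len e)) :=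
    fun r hr => Q.momentum_add e (hf.1 r hr) (hg.1 r hr)
  simp only [edgeOp, Q.momentum_congr e h h1.1, Q.momentum_add e h1.2 h2.2, Pi.add_apply, smul_add]
  abel

lemma edgeOp_smul (Q : RashbaNetwork) (e : Q.Edge) {f : ℝ → Spinor} (k : ℂ)
    (hf : MemH2 (Q.len e) f) :
    Q.edgeOp e (k • f) =ᵐ[Q.edgeMeasure e] k • Q.edgeOp e f := by
  filter_upwards [Q.ae_differentiable_momentum e hf] with t h1
  have h : EqOn (Q.momentum e (k • f)) (k • Q.momentum e f) (Icc 0 (Q.len e)) :=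
    fun r hr => Q.momentum_smul e k (hf.1 r hr)
  simp only [edgeOp, Q.momentum_congr e h h1.1, Q.momentum_smul e k h1.2, Pi.smul_apply, smul_add]
  rw [smul_comm]

lemma edgeOp_zero (Q : RashbaNetwork) (e : Q.Edge) : Q.edgeOp e 0 =ᵐ[Q.edgeMeasure e] 0 := by
  have h := Q.edgeOp_smul e 0 (MemH2.zero (l := Q.len e) (F := Spinor))
  simpa using h

lemma Represents.add {Q : RashbaNetwork} {f g : Q.Edge → ℝ → Spinor} {u v : Q.StateSpace}
    (hf : Q.Represents f u) (hg : Q.Represents g v) : Q.Represents (f + g) (u + v) := fun e =>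
  (Lp.coeFn_add (u e) (v e)).trans ((hf e).add (hg e))

lemma Represents.smul {Q : RashbaNetwork} {f : Q.Edge → ℝ → Spinor} {u : Q.StateSpace} (k : ℂ)
    (hf : Q.Represents f u) : Q.Represents (k • f) (k • u) := fun e =>
  (Lp.coeFn_smul k (u e)).trans ((hf e).const_smul k)

lemma represents_zero (Q : RashbaNetwork) : Q.Represents 0 0 := fun e =>
  Lp.coeFn_zero Spinor 2 (Q.edgeMeasure e)

/-- The graph of the maximal operator: all pairs `(u, v)` in the state space such that each component
of `u` is in `H²` of its edge and `v` is the image of `u` under the differential expressions. -/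
def maximalGraph (Q : RashbaNetwork) : Submodule ℂ (Q.StateSpace × Q.StateSpace) where
  carrier := {w | ∃ f : Q.Edge → ℝ → Spinor, (∀ e, MemH2 (Q.len e) (f e)) ∧
    Q.Represents f w.1 ∧ Q.Represents (fun e => Q.edgeOp e (f e)) w.2}
  add_mem' := by
    rintro w w' ⟨f, hf, h1, h2⟩ ⟨g, hg, h3, h4⟩
    exact ⟨f + g, fun e => (hf e).add (hg e), h1.add h3,
      fun e => ((h2.add h4) e).trans (Q.edgeOp_add e (hf e) (hg e)).symm⟩
  zero_mem' := ⟨0, fun _ => MemH2.zero, Q.represents_zero,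
    fun e => (Q.represents_zero e).trans (Q.edgeOp_zero e).symm⟩
  smul_mem' := by
    rintro k w ⟨f, hf, h1, h2⟩
    exact ⟨k • f, fun e => (hf e).smul k, h1.smul k,
      fun e => ((h2.smul k) e).trans (Q.edgeOp_smul e k (hf e)).symm⟩

lemma eqOn_of_represents (Q : RashbaNetwork) {f g : Q.Edge → ℝ → Spinor} {u : Q.StateSpace}
    (hf : ∀ e, MemH2 (Q.len e) (f e)) (hg : ∀ e, MemH2 (Q.len e) (g e))
    (h1 : Q.Represents f u) (h2 : Q.Represents g u) (e : Q.Edge) :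
    EqOn (f e) (g e) (Icc 0 (Q.len e)) :=
  Measure.eqOn_Icc_of_ae_eq volume (Q.len_pos e).ne ((h1 e).symm.trans (h2 e))
    (hf e).1.continuousOn (hg e).1.continuousOn

/-- The maximal graph is the graph of an operator. -/
lemma maximalGraph_single_valued (Q : RashbaNetwork) (w : Q.StateSpace × Q.StateSpace)
    (hw : w ∈ Q.maximalGraph) (h0 : w.1 = 0) : w.2 = 0 := by
  obtain ⟨f, hf, h1, h2⟩ := hw
  rw [h0] at h1
  refine lp.ext (funext fun e => Lp.ext ?_)
  have hEq := Q.edgeOp_congr e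
    (Q.eqOn_of_represents hf (fun _ => MemH2.zero) h1 Q.represents_zero e)
  have h3 : Q.edgeOp e (f e) =ᵐ[Q.edgeMeasure e] Q.edgeOp e 0 := by
    filter_upwards [ae_restrict_mem measurableSet_Icc] with t ht
    exact hEq ht
  exact ((h2 e).trans (h3.trans (Q.edgeOp_zero e))).trans (Q.represents_zero e).symm

/-- The maximal operator: it acts by the differential expressions on all states `u` whose components
are in `H²` of their edges and whose image is again square integrable. -/
def maximalOp (Q : RashbaNetwork) : Q.StateSpace →ₗ.[ℂ] Q.StateSpace := Q.maximalGraph.toLinearPMap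

lemma graph_maximalOp (Q : RashbaNetwork) : Q.maximalOp.graph = Q.maximalGraph :=
  Submodule.toLinearPMap_graph_eq _ Q.maximalGraph_single_valued

/-- The states with `H²` components that vanish at both ends of each edge. -/
def dirichletDomain (Q : RashbaNetwork) : Submodule ℂ Q.StateSpace where
  carrier := {u | ∃ f : Q.Edge → ℝ → Spinor, (∀ e, MemH2 (Q.len e) (f e)) ∧ Q.Represents f u ∧
    ∀ e, f e 0 = 0 ∧ f e (Q.len e) = 0}
  add_mem' := by
    rintro u v ⟨f, hf, h1, h2⟩ ⟨g, hg, h3, h4⟩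
    exact ⟨f + g, fun e => (hf e).add (hg e), h1.add h3,
      fun e => by simp [(h2 e).1, (h2 e).2, (h4 e).1, (h4 e).2]⟩
  zero_mem' := ⟨0, fun _ => MemH2.zero, Q.represents_zero, fun _ => ⟨rfl, rfl⟩⟩
  smul_mem' := by
    rintro k u ⟨f, hf, h1, h2⟩
    exact ⟨k • f, fun e => (hf e).smul k, h1.smul k, fun e => by simp [(h2 e).1, (h2 e).2]⟩

/-- The Dirichlet operator `D`. -/
def dirichletOp (Q : RashbaNetwork) : Q.StateSpace →ₗ.[ℂ] Q.StateSpace :=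
  Q.maximalOp.domRestrict Q.dirichletDomain

lemma left_mem (Q : RashbaNetwork) (e : Q.Edge) : (0 : ℝ) ∈ Icc 0 (Q.len e) :=
  ⟨le_rfl, (Q.len_pos e).le⟩

lemma right_mem (Q : RashbaNetwork) (e : Q.Edge) : Q.len e ∈ Icc 0 (Q.len e) :=
  ⟨(Q.len_pos e).le, le_rfl⟩

lemma covDeriv_add (Q : RashbaNetwork) (e : Q.Edge) {f g : ℝ → Spinor} {t : ℝ}
    (hf : MemH2 (Q.len e) f) (hg : MemH2 (Q.len e) g) (ht : t ∈ Icc 0 (Q.len e)) :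
    Q.covDeriv e (f + g) t = Q.covDeriv e f t + Q.covDeriv e g t := by
  simp only [covDeriv, segDeriv_add (hf.1 t ht) (hg.1 t ht), Pi.add_apply, map_add, smul_add]
  abel

lemma covDeriv_smul (Q : RashbaNetwork) (e : Q.Edge) {f : ℝ → Spinor} {t : ℝ} (k : ℂ)
    (hf : MemH2 (Q.len e) f) (ht : t ∈ Icc 0 (Q.len e)) :
    Q.covDeriv e (k • f) t = k • Q.covDeriv e f t := by
  simp only [covDeriv, segDeriv_smul k (hf.1 t ht), Pi.smul_apply, map_smul, smul_sub,
    smul_comm Complex.I k]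

lemma flux_add (Q : RashbaNetwork) {f g : Q.Edge → ℝ → Spinor}
    (hf : ∀ e, MemH2 (Q.len e) (f e)) (hg : ∀ e, MemH2 (Q.len e) (g e)) (α : Q.Vertex) :
    Q.flux (f + g) α = Q.flux f α + Q.flux g α := by
  simp only [flux, Pi.add_apply, fun e => Q.covDeriv_add e (hf e) (hg e) (Q.left_mem e),
    fun e => Q.covDeriv_add e (hf e) (hg e) (Q.right_mem e),
    finsum_mem_add_distrib (Q.finite_outEdges α), finsum_mem_add_distrib (Q.finite_inEdges α)]
  abel

lemma flux_smul (Q : RashbaNetwork) {f : Q.Edge → ℝ → Spinor} (k : ℂ)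
    (hf : ∀ e, MemH2 (Q.len e) (f e)) (α : Q.Vertex) :
    Q.flux (k • f) α = k • Q.flux f α := by
  simp only [flux, Pi.smul_apply, fun e => Q.covDeriv_smul e k (hf e) (Q.left_mem e),
    fun e => Q.covDeriv_smul e k (hf e) (Q.right_mem e), smul_sub,
    smul_finsum_mem (Q.finite_outEdges α), smul_finsum_mem (Q.finite_inEdges α)]

/-- The states with `H²` components that are continuous at all vertices, with vertex values `ξ`, and
satisfy the coupling condition `f'(α) = ε(α) ξ(α)` at each vertex `α`. -/
def hamiltonianDomain (Q : RashbaNetwork) : Submodule ℂ Q.StateSpace where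
  carrier := {u | ∃ (f : Q.Edge → ℝ → Spinor) (ξ : Q.Vertex → Spinor),
    (∀ e, MemH2 (Q.len e) (f e)) ∧ Q.Represents f u ∧ Q.HasVertexValues f ξ ∧
    ∀ α, Q.flux f α = (Q.ε α : ℂ) • ξ α}
  add_mem' := by
    rintro u v ⟨f, ξ, hf, h1, h2, h3⟩ ⟨g, η, hg, h4, h5, h6⟩
    refine ⟨f + g, ξ + η, fun e => (hf e).add (hg e), h1.add h4, fun e => ?_, fun α => ?_⟩
    · simp [(h2 e).1, (h2 e).2, (h5 e).1, (h5 e).2]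
    · rw [Q.flux_add hf hg, h3, h6, Pi.add_apply, smul_add]
  zero_mem' := by
    refine ⟨0, 0, fun _ => MemH2.zero, Q.represents_zero, fun _ => ⟨rfl, rfl⟩, fun α => ?_⟩
    have h := Q.flux_smul (f := 0) 0 (fun _ => MemH2.zero) α
    simpa using h
  smul_mem' := by
    rintro k u ⟨f, ξ, hf, h1, h2, h3⟩
    refine ⟨k • f, k • ξ, fun e => (hf e).smul k, h1.smul k, fun e => ?_, fun α => ?_⟩
    · simp [(h2 e).1, (h2 e).2]
    · rw [Q.flux_smul k hf, h3, Pi.smul_apply, smul_comm]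

/-- The Hamiltonian `L`. -/
def hamiltonian (Q : RashbaNetwork) : Q.StateSpace →ₗ.[ℂ] Q.StateSpace :=
  Q.maximalOp.domRestrict Q.hamiltonianDomain

/-- `f` is an eigenfunction of `L` with eigenvalue `E`: it represents a nonzero vector `u` of the
domain of `L` with `L u = E u`. -/
def IsEigenfunction (Q : RashbaNetwork) (E : ℂ) (f : Q.Edge → ℝ → Spinor) : Prop :=
  ∃ u : Q.hamiltonian.domain, (u : Q.StateSpace) ≠ 0 ∧ Q.Represents f u ∧
    Q.hamiltonian u = E • (u : Q.StateSpace)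

end RashbaNetwork

/-- The spectrum of an unbounded operator `T`: all `z` such that `T - z` does not have a bounded
everywhere defined inverse `R`. -/
def LinearPMap.unboundedSpectrum {H : Type*} [NormedAddCommGroup H] [NormedSpace ℂ H]
    (T : H →ₗ.[ℂ] H) : Set ℂ :=
  {z | ¬ ∃ R : H →L[ℂ] H,
    (∀ x : T.domain, R (T x - z • (x : H)) = x) ∧
    ∀ h : H, ∃ x : T.domain, (x : H) = R h ∧ T x - z • (x : H) = h}

end

/-! Along a straight edge `σ` is constant, so the values of the gauge potential at different points
commute. Hence `Θ` is unitary and satisfies `Θ' = i (a + k_R σ) Θ`. Writing `f = Θ g` removes the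
gauge potential: `(L - E) f = 0` becomes `g'' = (U - z) g`, the covariant derivative of `f` becomes
`Θ g'`, and norms are preserved pointwise (`hasDerivAt_Θ`, `covDeriv_Θ`, `edgeOp_Θ`).

The assumption on `E` is used through the resolvent of `D` only. A Dirichlet problem on one edge,
extended by zero, is a problem for `D`, so the norm of the resolvent gives one a priori bound for
all edges (`exists_dirichlet_bound`). Subtracting from `g` the affine interpolant of its end values
turns this into `‖g‖ ≤ C (|g(0)| + |g(l)|)` in `L²`, uniformly in the edge
(`exists_solution_bound`). In particular, solutions are determined by their end values
(`hillSolution_eqOn`). It follows that `s(l) ≠ 0`, and that `g` is the combination of `s` and `c`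
with the right end values, which is statement 1. Differentiating this combination at both ends, with
`c'(l)` eliminated by the Wronskian identity, and summing over the edges at a vertex gives statement
2.

Statement 3 also needs the reverse bound: Green's formula against suitable cubics gives `|g(0)|,
|g(l)| ≤ C ‖g‖`, again uniformly in the edge (`exists_boundary_bound`). Both bounds are squared and
summed over the graph; the degree bounds control how often an edge or a vertex is counted
(`squareIntegrable_iff_memℓp`).

Since `U` is only in `L²`, second derivatives exist only almost everywhere. The calculus therefore
rests on an integrated product rule (`bilinear_eq_add_integral`), and `s` and `c` are obtained from
a Volterra equation (`exists_volterra`). -/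

noncomputable section

/-! ### Product rule for absolutely continuous functions -/

section bilinear

variable {E F G : Type*} [NormedAddCommGroup E] [NormedSpace ℝ E] [CompleteSpace E]
  [NormedAddCommGroup F] [NormedSpace ℝ F] [CompleteSpace F]
  [NormedAddCommGroup G] [NormedSpace ℝ G] [CompleteSpace G]

/-- Fubini's theorem on a triangle, for a bilinear map of two integrable functions. -/
lemma integral_bilinear_primitive (L : E →L[ℝ] F →L[ℝ] G) {t : ℝ} (ht : 0 ≤ t) {b : ℝ → E}
    {g : ℝ → F} (hb : IntegrableOn b (Ioc 0 t)) (hg : IntegrableOn g (Ioc 0 t)) :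
    ∫ r in (0 : ℝ)..t, L (b r) (∫ s in (0 : ℝ)..r, g s) =
      ∫ s in (0 : ℝ)..t, L (∫ r in s..t, b r) (g s) := by
  set μ := volume.restrict (Ioc 0 t) with hμ
  have hint : Integrable (fun x : ℝ × ℝ => L (b x.1) (g x.2)) (μ.prod μ) :=
    hb.op_fst_snd (op := fun x y => L x y) (by fun_prop) ⟨‖L‖, fun x y => L.le_opNorm₂ x y⟩ hg
  -- The triangle `s ≤ r` is encoded by an indicator, so that both iterated integrals run over the
  -- full interval and can be swapped.
  have hS : MeasurableSet {x : ℝ × ℝ | x.2 ≤ x.1} := measurableSet_le measurable_snd measurable_fst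
  have hint' := hint.indicator hS
  have hswap := integral_integral_swap (f := fun r s =>
    ({x : ℝ × ℝ | x.2 ≤ x.1}).indicator (fun x : ℝ × ℝ => L (b x.1) (g x.2)) (r, s)) hint'
  rw [intervalIntegral.integral_of_le ht, intervalIntegral.integral_of_le ht]
  refine Eq.trans ?_ (hswap.trans ?_)
  · refine setIntegral_congr_fun measurableSet_Ioc fun r hr => ?_
    have hsub : Ioc 0 r ⊆ Ioc 0 t := Ioc_subset_Ioc_right hr.2
    have h1 : ∀ s, ({x : ℝ × ℝ | x.2 ≤ x.1}).indicator (fun x : ℝ × ℝ => L (b x.1) (g x.2)) (r, s) =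
        (Iic r).indicator (fun s => L (b r) (g s)) s := fun s => by
      by_cases h : s ≤ r <;> simp [indicator, h]
    simp only [h1]
    rw [setIntegral_indicator measurableSet_Iic, Ioc_inter_Iic, min_eq_right hr.2,
      intervalIntegral.integral_of_le hr.1.le,
      ContinuousLinearMap.integral_comp_comm (L (b r)) (hg.mono_set hsub)]
  · refine setIntegral_congr_fun measurableSet_Ioc fun s hs => ?_
    have h1 : ∀ r, ({x : ℝ × ℝ | x.2 ≤ x.1}).indicator (fun x : ℝ × ℝ => L (b x.1) (g x.2)) (r, s) =
        (Ici s).indicator (fun r => L.flip (g s) (b r)) r := fun r => by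
      by_cases h : s ≤ r <;> simp [indicator, h]
    simp only [h1]
    rw [setIntegral_indicator measurableSet_Ici]
    have h2 : (Ioc 0 t ∩ Ici s : Set ℝ) =ᵐ[volume] Ioc s t := by
      have : Ioc 0 t ∩ Ici s = Icc s t := by
        ext r
        simp only [mem_inter_iff, mem_Ioc, mem_Ici, mem_Icc]
        exact ⟨fun h => ⟨h.2, h.1.2⟩, fun h => ⟨⟨hs.1.trans_le h.1, h.2⟩, h.1⟩⟩
      rw [this]
      exact Ioc_ae_eq_Icc.symm
    rw [setIntegral_congr_set h2, intervalIntegral.integral_of_le hs.2,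
      ContinuousLinearMap.integral_comp_comm (L.flip (g s))
        (hb.mono_set (Ioc_subset_Ioc_left hs.1.le))]
    rfl

/-- Product rule in integrated form, for a `C¹` function and an absolutely continuous one. -/
lemma bilinear_eq_add_integral (L : E →L[ℝ] F →L[ℝ] G) {l t : ℝ} (ht : t ∈ Icc 0 l)
    {B b : ℝ → E} {H g : ℝ → F} (hB : ∀ r ∈ Icc 0 l, HasDerivWithinAt B (b r) (Icc 0 l) r)
    (hb : ContinuousOn b (Icc 0 l)) (hg : IntegrableOn g (Icc 0 l))
    (hH : ∀ r ∈ Icc 0 l, H r = H 0 + ∫ s in (0 : ℝ)..r, g s) :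
    L (B t) (H t) = L (B 0) (H 0) + ∫ r in (0 : ℝ)..t, (L (b r) (H r) + L (B r) (g r)) := by
  have hsub : Icc 0 t ⊆ Icc 0 l := Icc_subset_Icc_right ht.2
  have hsub' : Ioc 0 t ⊆ Icc 0 l := Ioc_subset_Icc_self.trans hsub
  have hBc : ContinuousOn B (Icc 0 l) := fun r hr => (hB r hr).continuousWithinAt
  have hftc : ∀ s ∈ Icc 0 t, ∫ r in s..t, b r = B t - B s := fun s hs => by
    have hss : Icc s t ⊆ Icc 0 l := (Icc_subset_Icc_left hs.1).trans hsub
    refine intervalIntegral.integral_eq_sub_of_hasDerivAt_of_le hs.2 (hBc.mono hss)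
      (fun r hr => ?_) ?_
    · exact (hB r (hss (Ioo_subset_Icc_self hr))).hasDerivAt
        (Icc_mem_nhds (hs.1.trans_lt hr.1) (hr.2.trans_le ht.2))
    · exact (hb.mono (by rwa [uIcc_of_le hs.2])).intervalIntegrable
  have hgt : IntervalIntegrable g volume 0 t := by
    rw [intervalIntegrable_iff, uIoc_of_le ht.1]
    exact hg.mono_set hsub'
  have hbt : ContinuousOn b (uIcc 0 t) := by
    rw [uIcc_of_le ht.1]; exact hb.mono hsub
  have hBt : ContinuousOn B (uIcc 0 t) := by
    rw [uIcc_of_le ht.1]; exact hBc.mono hsub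
  have hprim : ContinuousOn (fun r => ∫ s in (0 : ℝ)..r, g s) (uIcc 0 t) :=
    intervalIntegral.continuousOn_primitive_interval (by
      rw [uIcc_of_le ht.1]; exact hg.mono_set hsub)
  have hi1 : IntervalIntegrable (fun r => L (b r) (H 0)) volume 0 t :=
    ContinuousOn.intervalIntegrable (by fun_prop)
  have hi2 : IntervalIntegrable (fun r => L (b r) (∫ s in (0 : ℝ)..r, g s)) volume 0 t :=
    ContinuousOn.intervalIntegrable (by fun_prop)
  have hbil : ∀ A : ℝ → E, ContinuousOn A (uIcc 0 t) →
      IntervalIntegrable (fun r => L (A r) (g r)) volume 0 t := fun A hA => by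
    obtain ⟨C, hC⟩ := isCompact_uIcc.exists_bound_of_continuousOn hA
    rw [intervalIntegrable_iff] at hgt ⊢
    refine Integrable.mono' (hgt.norm.const_mul (‖L‖ * C)) ?_ ?_
    · exact L.aestronglyMeasurable_comp₂
        ((hA.mono uIoc_subset_uIcc).aestronglyMeasurable measurableSet_uIoc) hgt.1
    · filter_upwards [ae_restrict_mem measurableSet_uIoc] with r hr
      refine (L.le_opNorm₂ _ _).trans ?_
      gcongr
      exact hC r (uIoc_subset_uIcc hr)
  have hi3 := hbil B hBt
  have hi4 := hbil (fun _ => B t) continuousOn_const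
  -- With `H r = H 0 + ∫ g`, Fubini turns the term `L (b r) (∫ g)` into `∫ L (B t - B s) (g s)`. Its
  -- second half cancels `∫ L (B r) (g r)`, leaving only boundary terms.
  have key := integral_bilinear_primitive L ht.1
    ((hb.mono hsub).integrableOn_Icc.mono_set Ioc_subset_Icc_self) (hg.mono_set hsub')
  have e1 : ∫ s in (0 : ℝ)..t, L (∫ r in s..t, b r) (g s) =
      ∫ s in (0 : ℝ)..t, (L (B t) (g s) - L (B s) (g s)) := by
    refine intervalIntegral.integral_congr fun s hs => ?_
    rw [uIcc_of_le ht.1] at hs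
    simp only [hftc s hs, map_sub, sub_apply]
  have e2 : ∫ r in (0 : ℝ)..t, (L (b r) (H r) + L (B r) (g r)) =
      ∫ r in (0 : ℝ)..t, (L (b r) (H 0) + L (b r) (∫ s in (0 : ℝ)..r, g s) + L (B r) (g r)) := by
    refine intervalIntegral.integral_congr fun r hr => ?_
    rw [uIcc_of_le ht.1] at hr
    simp only [hH r (hsub hr), map_add]
  have e3 : ∫ r in (0 : ℝ)..t, L (b r) (H 0) = L (B t) (H 0) - L (B 0) (H 0) := by
    have h := (L.flip (H 0)).intervalIntegral_comp_comm (hbt.intervalIntegrable (μ := volume))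
    simp only [ContinuousLinearMap.flip_apply] at h
    rw [h, hftc 0 ⟨le_rfl, ht.1⟩, map_sub, sub_apply]
  have e4 := (L (B t)).intervalIntegral_comp_comm hgt
  rw [e2, intervalIntegral.integral_add (hi1.add hi2) hi3, intervalIntegral.integral_add hi1 hi2,
    e3, key, e1, intervalIntegral.integral_sub hi4 hi3, e4, hH t ht, map_add (L (B t))]
  abel

end bilinear

/-! ### Calculus in `H²` of a segment -/

lemma memLp_of_continuousOn {F : Type*} [NormedAddCommGroup F] {l : ℝ} {f : ℝ → F} (hf : ContinuousOn f (Icc 0 l)) (p : ℝ≥0∞) :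
    MemLp f p (volume.restrict (Icc 0 l)) := by
  obtain ⟨C, hC⟩ := isCompact_Icc.exists_bound_of_continuousOn hf
  refine MemLp.of_bound (hf.aestronglyMeasurable measurableSet_Icc) C ?_
  filter_upwards [ae_restrict_mem measurableSet_Icc] with t ht
  exact hC t ht

lemma MemLp.bilinear_of_continuousOn {E F G : Type*} [NormedAddCommGroup E]
    [NormedSpace ℝ E] [NormedAddCommGroup F] [NormedSpace ℝ F] [NormedAddCommGroup G]
    [NormedSpace ℝ G] {l : ℝ} (L : E →L[ℝ] F →L[ℝ] G) {B : ℝ → E} {g : ℝ → F}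
    (hB : ContinuousOn B (Icc 0 l)) (hg : MemLp g 2 (volume.restrict (Icc 0 l))) :
    MemLp (fun t => L (B t) (g t)) 2 (volume.restrict (Icc 0 l)) := by
  obtain ⟨C, hC⟩ := isCompact_Icc.exists_bound_of_continuousOn hB
  refine hg.of_le_mul (c := ‖L‖ * C) (L.aestronglyMeasurable_comp₂
    (hB.aestronglyMeasurable measurableSet_Icc) hg.1) ?_
  filter_upwards [ae_restrict_mem measurableSet_Icc] with t ht
  refine (L.le_opNorm₂ _ _).trans ?_
  gcongr
  exact hC t ht

section segment

variable {F : Type*} [NormedAddCommGroup F] [NormedSpace ℝ F] {l : ℝ}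

lemma segDeriv_eq (hl : 0 < l) {f : ℝ → F} {f' : F} {t : ℝ} (ht : t ∈ Icc 0 l)
    (h : HasDerivWithinAt f f' (Icc 0 l) t) : segDeriv l f t = f' :=
  h.derivWithin (uniqueDiffOn_Icc hl t ht)

lemma MemH2.hasDerivWithinAt {f : ℝ → F} (hf : MemH2 l f) {t : ℝ} (ht : t ∈ Icc 0 l) :
    HasDerivWithinAt f (segDeriv l f t) (Icc 0 l) t := (hf.1 t ht).hasDerivWithinAt

/-- Lebesgue differentiation of the primitive of `g`. -/
lemma ae_hasDerivWithinAt_primitive [CompleteSpace F] (hl : 0 < l) {f' g : ℝ → F}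
    (hg : MemLp g 2 (volume.restrict (Icc 0 l)))
    (h' : ∀ t ∈ Icc 0 l, f' t = f' 0 + ∫ s in (0 : ℝ)..t, g s) :
    ∀ᵐ t ∂(volume.restrict (Icc 0 l)), HasDerivWithinAt f' (g t) (Icc 0 l) t := by
  rw [ae_restrict_iff' measurableSet_Icc]
  have hi := intervalIntegrable_of_memLp hg (t := l) ⟨hl.le, le_rfl⟩
  filter_upwards [hi.ae_hasDerivAt_integral] with t ht hmem
  rw [uIcc_of_le hl.le] at ht
  have h1 := (ht hmem 0 ⟨le_rfl, hl.le⟩).hasDerivWithinAt (s := Icc 0 l)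
  exact (h1.const_add (f' 0)).congr h' (h' t hmem)

/-- The criterion by which membership in `H²` is checked: a first derivative that is the primitive
of some `g ∈ L²`. It also identifies both derivatives with the given candidates. -/
lemma MemH2.of_hasDerivWithinAt [CompleteSpace F] (hl : 0 < l) {f f' g : ℝ → F}
    (hf : ∀ t ∈ Icc 0 l, HasDerivWithinAt f (f' t) (Icc 0 l) t)
    (hg : MemLp g 2 (volume.restrict (Icc 0 l)))
    (h' : ∀ t ∈ Icc 0 l, f' t = f' 0 + ∫ s in (0 : ℝ)..t, g s) :
    MemH2 l f ∧ EqOn (segDeriv l f) f' (Icc 0 l) ∧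
      segDeriv l (segDeriv l f) =ᵐ[volume.restrict (Icc 0 l)] g := by
  have h1 : EqOn (segDeriv l f) f' (Icc 0 l) := fun t ht => segDeriv_eq hl ht (hf t ht)
  refine ⟨⟨fun t ht => (hf t ht).differentiableWithinAt, g, hg, fun t ht => ?_⟩, h1, ?_⟩
  · rw [h1 ht, h1 ⟨le_rfl, hl.le⟩, h' t ht]
  · filter_upwards [ae_hasDerivWithinAt_primitive hl hg h', ae_restrict_mem measurableSet_Icc]
      with t ht hmem
    exact segDeriv_eq hl hmem (ht.congr h1 (h1 hmem))

/-- The second derivative in `MemH2` is only asserted to exist. By Lebesgue differentiation it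
agrees almost everywhere with the iterated `segDeriv`, which can therefore serve as the canonical
choice. -/
lemma MemH2.segDeriv_segDeriv [CompleteSpace F] (hl : 0 < l) {f : ℝ → F} (hf : MemH2 l f) :
    MemLp (segDeriv l (segDeriv l f)) 2 (volume.restrict (Icc 0 l)) ∧
    (∀ᵐ t ∂(volume.restrict (Icc 0 l)),
      HasDerivWithinAt (segDeriv l f) (segDeriv l (segDeriv l f) t) (Icc 0 l) t) ∧
    ∀ t ∈ Icc 0 l, segDeriv l f t =
      segDeriv l f 0 + ∫ s in (0 : ℝ)..t, segDeriv l (segDeriv l f) s := by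
  obtain ⟨g, hg, h⟩ := hf.2
  have h2 := (MemH2.of_hasDerivWithinAt hl (fun t ht => hf.hasDerivWithinAt ht) hg h).2.2
  refine ⟨hg.ae_eq h2.symm, ?_, fun t ht => ?_⟩
  · filter_upwards [ae_hasDerivWithinAt_primitive hl hg h, h2] with t ht h3
    rwa [h3]
  · rw [h t ht]
    congr 1
    refine intervalIntegral.integral_congr_ae ?_
    rw [Filter.EventuallyEq, ae_restrict_iff' measurableSet_Icc] at h2
    filter_upwards [h2] with s hs hmem
    rw [uIoc_of_le ht.1] at hmem
    exact (hs ⟨hmem.1.le, hmem.2.trans ht.2⟩).symm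

lemma MemH2.continuousOn {f : ℝ → F} (hf : MemH2 l f) : ContinuousOn f (Icc 0 l) :=
  hf.1.continuousOn

lemma MemH2.continuousOn_segDeriv [CompleteSpace F] (hl : 0 < l) {f : ℝ → F} (hf : MemH2 l f) :
    ContinuousOn (segDeriv l f) (Icc 0 l) := by
  obtain ⟨h1, -, h2⟩ := hf.segDeriv_segDeriv hl
  have h3 : IntegrableOn (segDeriv l (segDeriv l f)) (uIcc 0 l) := by
    rw [uIcc_of_le hl.le]
    exact h1.integrable (by norm_num)
  have h4 := intervalIntegral.continuousOn_primitive_interval h3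
  rw [uIcc_of_le hl.le] at h4
  exact (continuousOn_const.add h4).congr h2

lemma MemH2.eq_add_integral [CompleteSpace F] (hl : 0 < l) {f : ℝ → F} (hf : MemH2 l f) :
    ∀ r ∈ Icc 0 l, f r = f 0 + ∫ s in (0 : ℝ)..r, segDeriv l f s := fun r hr => by
  have hss : Icc 0 r ⊆ Icc 0 l := Icc_subset_Icc_right hr.2
  have := intervalIntegral.integral_eq_sub_of_hasDerivAt_of_le hr.1 (hf.continuousOn.mono hss)
    (fun s hs => (hf.hasDerivWithinAt (hss (Ioo_subset_Icc_self hs))).hasDerivAt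
      (Icc_mem_nhds hs.1 (hs.2.trans_le hr.2)))
    (ContinuousOn.intervalIntegrable (by
      rw [uIcc_of_le hr.1]; exact (hf.continuousOn_segDeriv hl).mono hss))
  rw [this]; abel

variable {E G : Type*} [NormedAddCommGroup E] [NormedSpace ℝ E] [CompleteSpace E]
  [NormedAddCommGroup G] [NormedSpace ℝ G] [CompleteSpace G] [CompleteSpace F]

/-- A bilinear product of a `C²` function with an `H²` function is in `H²`. -/
lemma MemH2.bilinear (hl : 0 < l) (L : E →L[ℝ] F →L[ℝ] G) {B B' B'' : ℝ → E} {f : ℝ → F}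
    (hB : ∀ t ∈ Icc 0 l, HasDerivWithinAt B (B' t) (Icc 0 l) t)
    (hB' : ∀ t ∈ Icc 0 l, HasDerivWithinAt B' (B'' t) (Icc 0 l) t)
    (hB'' : ContinuousOn B'' (Icc 0 l)) (hf : MemH2 l f) :
    MemH2 l (fun t => L (B t) (f t)) ∧
    (∀ t ∈ Icc 0 l, segDeriv l (fun t => L (B t) (f t)) t =
      L (B' t) (f t) + L (B t) (segDeriv l f t)) := by
  have hBc : ContinuousOn B (Icc 0 l) := fun r hr => (hB r hr).continuousWithinAt
  have hBc' : ContinuousOn B' (Icc 0 l) := fun r hr => (hB' r hr).continuousWithinAt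
  obtain ⟨h1, -, h2⟩ := hf.segDeriv_segDeriv hl
  have hfc' := hf.continuousOn_segDeriv hl
  have hfc := hf.continuousOn
  have m1 : ∀ {B : ℝ → E} {f : ℝ → F}, ContinuousOn B (Icc 0 l) → ContinuousOn f (Icc 0 l) →
      MemLp (fun t => L (B t) (f t)) 2 (volume.restrict (Icc 0 l)) := fun hB hf =>
    memLp_of_continuousOn (by fun_prop) 2
  have m2 := MemLp.bilinear_of_continuousOn L hBc h1
  have hi1 : IntegrableOn (segDeriv l (segDeriv l f)) (Icc 0 l) := h1.integrable (by norm_num)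
  have hd : ∀ t ∈ Icc 0 l, HasDerivWithinAt (fun t => L (B t) (f t))
      (L (B' t) (f t) + L (B t) (segDeriv l f t)) (Icc 0 l) t := fun t ht => by
    have := L.hasFDerivWithinAt_of_bilinear (hB t ht).hasFDerivWithinAt
      (hf.hasDerivWithinAt ht).hasFDerivWithinAt
    refine this.hasDerivWithinAt.congr_deriv ?_
    simp [add_comm]
  refine ⟨(MemH2.of_hasDerivWithinAt (g := fun t => (L (B'' t) (f t) + L (B' t) (segDeriv l f t)) +
    (L (B' t) (segDeriv l f t) + L (B t) (segDeriv l (segDeriv l f) t))) hl hd ?_ ?_).1,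
    fun t ht => segDeriv_eq hl ht (hd t ht)⟩
  · exact ((m1 hB'' hfc).add (m1 hBc' hfc')).add ((m1 hBc' hfc').add m2)
  · intro t ht
    -- The derivative of the product is `B' f + B f'`. The integrated product rule applies to each
    -- summand, since one factor is always `C¹`.
    have a1 := bilinear_eq_add_integral L ht hB' hB'' hfc'.integrableOn_Icc
      (hf.eq_add_integral hl)
    have a2 := bilinear_eq_add_integral L ht hB hBc' hi1 h2
    rw [intervalIntegral.integral_add, a1, a2]
    · abel
    · exact intervalIntegrable_of_memLp ((m1 hB'' hfc).add (m1 hBc' hfc')) ht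
    · exact intervalIntegrable_of_memLp ((m1 hBc' hfc').add m2) ht

/-- Integration by parts for `f''` against a `C¹` function. -/
lemma MemH2.integral_bilinear (hl : 0 < l) (L : E →L[ℝ] F →L[ℝ] G) {B B' : ℝ → E} {f : ℝ → F}
    (hB : ∀ t ∈ Icc 0 l, HasDerivWithinAt B (B' t) (Icc 0 l) t)
    (hB' : ContinuousOn B' (Icc 0 l)) (hf : MemH2 l f) :
    L (B l) (segDeriv l f l) = L (B 0) (segDeriv l f 0) +
      ∫ t in (0 : ℝ)..l, (L (B' t) (segDeriv l f t) + L (B t) (segDeriv l (segDeriv l f) t)) := by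
  obtain ⟨h1, -, h2⟩ := hf.segDeriv_segDeriv hl
  exact bilinear_eq_add_integral L ⟨hl.le, le_rfl⟩ hB hB' (h1.integrable (by norm_num)) h2

end segment

/-! ### Initial value problem with an `L²` potential -/

section initialValue

variable {l : ℝ}

/-- Follows from `1 + a x ≤ exp (a x)`. It bounds the weighted Volterra kernel. -/
lemma mul_exp_neg_mul_le {a x : ℝ} (ha : 0 < a) :
    x * Real.exp (-(a * x)) ≤ a⁻¹ := by
  rw [Real.exp_neg, ← div_eq_mul_inv, div_le_iff₀ (Real.exp_pos _), inv_mul_eq_div, le_div_iff₀ ha]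
  linarith [Real.add_one_le_exp (a * x)]

/-- The Volterra integral equation with kernel `(t - r) V(r)` has a continuous solution. -/
lemma exists_volterra (hl : 0 < l) {V : ℝ → ℂ} (hV : IntegrableOn V (Icc 0 l)) (p q : ℂ) :
    ∃ y : ℝ → ℂ, Continuous y ∧ ∀ t ∈ Icc 0 l,
      y t = p + t * q + ∫ r in (0 : ℝ)..t, ((t - r : ℝ) : ℂ) * (V r * y r) := by
  set W : ℝ → ℂ := (Icc 0 l).indicator V with hWdef
  have hW : Integrable W := hV.integrable_indicator measurableSet_Icc
  set K : ℝ := ∫ r, ‖W r‖ with hK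
  have hK0 : 0 ≤ K := integral_nonneg fun _ => norm_nonneg _
  -- Bielecki weight: the unknown is `w t = exp (-a t) y t`. The kernel becomes `(t - r) exp (-a (t
  -- - r)) ≤ 1 / a`, so the Lipschitz constant is at most `K / a ≤ 1 / 2` on the whole segment,
  -- whatever its length.
  set a : ℝ := 2 * K + 1 with ha
  have ha0 : 0 < a := by positivity
  have : Fact ((0 : ℝ) ≤ l) := ⟨hl.le⟩
  let ext : C(Icc (0 : ℝ) l, ℂ) → ℝ → ℂ := fun w => IccExtend hl.le w
  have hext : ∀ w, Continuous (ext w) := fun w => w.continuous.Icc_extend'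
  have hextn : ∀ w r, ‖ext w r‖ ≤ ‖w‖ := fun w r => w.norm_coe_le_norm _
  have hbm : ∀ (w : C(Icc (0 : ℝ) l, ℂ)) (k : ℝ → ℂ), Continuous k → ∀ t t',
      IntervalIntegrable (fun r => k r * (W r * ext w r)) volume t t' := fun w k hk t t' => by
    have h1 : IntervalIntegrable (fun r => W r * (k r * ext w r)) volume t t' :=
      hW.intervalIntegrable.mul_continuousOn (hk.mul (hext w)).continuousOn
    exact h1.congr (fun r _ => by ring)
  let S : C(Icc (0 : ℝ) l, ℂ) → ℝ → ℂ := fun w t =>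
    ∫ r in (0 : ℝ)..t, (((t - r) * Real.exp (-(a * (t - r))) : ℝ) : ℂ) * (W r * ext w r)
  have hS : ∀ w, Continuous (S w) := fun w => by
    -- Separating the variables `t` and `r` in the kernel expresses `S w` through primitives of
    -- integrable functions, which are continuous.
    have e : S w = fun t => (Real.exp (-(a * t)) : ℂ) *
        ((t : ℂ) * (∫ r in (0 : ℝ)..t, (Real.exp (a * r) : ℂ) * (W r * ext w r)) -
          ∫ r in (0 : ℝ)..t, ((r * Real.exp (a * r) : ℝ) : ℂ) * (W r * ext w r)) := by
      funext t
      rw [← intervalIntegral.integral_const_mul, ← intervalIntegral.integral_sub,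
        ← intervalIntegral.integral_const_mul]
      · refine intervalIntegral.integral_congr fun r _ => ?_
        have : -(a * (t - r)) = -(a * t) + a * r := by ring
        simp only [this, Real.exp_add]
        push_cast
        ring
      · exact (hbm w _ (by fun_prop) 0 t).const_mul _
      · exact hbm w _ (by fun_prop) 0 t
    rw [e]
    have c1 := intervalIntegral.continuous_primitive
      (hbm w (fun r => (Real.exp (a * r) : ℂ)) (by fun_prop)) 0
    have c2 := intervalIntegral.continuous_primitive
      (hbm w (fun r => ((r * Real.exp (a * r) : ℝ) : ℂ)) (by fun_prop)) 0
    fun_prop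
  let Φ : C(Icc (0 : ℝ) l, ℂ) → C(Icc (0 : ℝ) l, ℂ) := fun w =>
    ⟨fun t => (Real.exp (-(a * t)) : ℂ) * (p + (t : ℝ) * q) + S w t, by
      have := hS w
      fun_prop⟩
  have hΦ : ContractingWith (1 / 2) Φ := by
    refine ⟨by norm_num, LipschitzWith.of_dist_le_mul fun w v => ?_⟩
    rw [ContinuousMap.dist_le (by positivity)]
    intro t
    have ht := t.2
    have e : Φ w t - Φ v t = ∫ r in (0 : ℝ)..t,
        (((t - r) * Real.exp (-(a * (t - r))) : ℝ) : ℂ) * (W r * ext (w - v) r) := by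
      simp only [Φ, S, ContinuousMap.coe_mk, add_sub_add_left_eq_sub]
      rw [← intervalIntegral.integral_sub (hbm w _ (by fun_prop) _ _) (hbm v _ (by fun_prop) _ _)]
      refine intervalIntegral.integral_congr fun r _ => ?_
      have : ext (w - v) r = ext w r - ext v r := rfl
      simp only [this]
      ring
    rw [dist_eq_norm, e, dist_eq_norm]
    calc ‖∫ r in (0 : ℝ)..t, (((t - r) * Real.exp (-(a * (t - r))) : ℝ) : ℂ) *
            (W r * ext (w - v) r)‖
        ≤ ∫ r in (0 : ℝ)..t, a⁻¹ * ‖w - v‖ * ‖W r‖ := by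
          refine intervalIntegral.norm_integral_le_of_norm_le ht.1 ?_
            (hW.norm.const_mul _).intervalIntegrable
          refine Filter.Eventually.of_forall fun r hr => ?_
          have h0 : 0 ≤ t - r := sub_nonneg.2 hr.2
          rw [norm_mul, norm_mul, Complex.norm_real, Real.norm_of_nonneg (by positivity)]
          calc _ ≤ a⁻¹ * (‖W r‖ * ‖w - v‖) := by
                gcongr
                · exact mul_exp_neg_mul_le ha0
                · exact hextn _ _
            _ = _ := by ring
      _ = a⁻¹ * ‖w - v‖ * ∫ r in (0 : ℝ)..t, ‖W r‖ := by
          rw [intervalIntegral.integral_const_mul]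
      _ ≤ a⁻¹ * ‖w - v‖ * K := by
          gcongr
          rw [intervalIntegral.integral_of_le ht.1]
          exact setIntegral_le_integral hW.norm (Filter.Eventually.of_forall fun _ => norm_nonneg _)
      _ = (K / a) * ‖w - v‖ := by ring
      _ ≤ ((1 / 2 : NNReal) : ℝ) * ‖w - v‖ := by
          gcongr
          rw [div_le_iff₀ ha0, ha]
          push_cast
          linarith
  obtain ⟨w, hw⟩ : ∃ w, Φ w = w := ⟨_, hΦ.fixedPoint_isFixedPt⟩
  refine ⟨fun t => (Real.exp (a * t) : ℂ) * ext w t, by have := hext w; fun_prop, fun t ht => ?_⟩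
  have h1 : ext w t = (Real.exp (-(a * t)) : ℂ) * (p + (t : ℝ) * q) + S w t := by
    have : ext w t = w ⟨t, ht⟩ := IccExtend_of_mem hl.le _ ht
    rw [this]
    conv_lhs => rw [← hw]
    rfl
  have h2 : (Real.exp (a * t) : ℂ) * (Real.exp (-(a * t)) : ℂ) = 1 := by
    rw [← Complex.ofReal_mul, ← Real.exp_add]; simp
  simp only [h1, mul_add, ← mul_assoc, h2, one_mul]
  congr 1
  simp only [S]
  rw [← intervalIntegral.integral_const_mul]
  refine intervalIntegral.integral_congr fun r hr => ?_
  rw [uIcc_of_le ht.1] at hr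
  have hWr : W r = V r := indicator_of_mem (show r ∈ Icc 0 l from ⟨hr.1, hr.2.trans ht.2⟩) V
  have : Real.exp (a * t) * Real.exp (-(a * (t - r))) = Real.exp (a * r) := by
    rw [← Real.exp_add]; congr 1; ring
  have h3 : (Real.exp (a * t) : ℂ) * (Real.exp (-(a * (t - r))) : ℂ) = (Real.exp (a * r) : ℂ) := by
    rw [← Complex.ofReal_mul, this]
  simp only [hWr, ← h3]
  push_cast
  ring

/-- The initial value problem `y'' = V y`, `y(0) = p`, `y'(0) = q` with `V ∈ L²` has a solution in
`H²`. -/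
lemma exists_memH2_initialValue (hl : 0 < l) {V : ℝ → ℂ}
    (hV : MemLp V 2 (volume.restrict (Icc 0 l))) (p q : ℂ) :
    ∃ y : ℝ → ℂ, MemH2 l y ∧ y 0 = p ∧ segDeriv l y 0 = q ∧
      segDeriv l (segDeriv l y) =ᵐ[volume.restrict (Icc 0 l)] fun t => V t * y t := by
  obtain ⟨y, hyc, hy⟩ := exists_volterra hl (hV.integrable (by norm_num)) p q
  have h0 : (0 : ℝ) ∈ Icc 0 l := ⟨le_rfl, hl.le⟩
  have hg : MemLp (fun t => V t * y t) 2 (volume.restrict (Icc 0 l)) := by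
    have := MemLp.bilinear_of_continuousOn (ContinuousLinearMap.mul ℝ ℂ) hyc.continuousOn hV
    simpa [mul_comm] using this
  -- The prospective derivative of `y`.
  set H : ℝ → ℂ := fun t => q + ∫ s in (0 : ℝ)..t, V s * y s with hH
  have hH0 : H 0 = q := by simp [hH]
  have hHeq : ∀ t ∈ Icc 0 l, H t = H 0 + ∫ s in (0 : ℝ)..t, V s * y s := fun t _ => by
    rw [hH0]
  have hgi : IntegrableOn (fun t => V t * y t) (Icc 0 l) := hg.integrable (by norm_num)
  have hHc : ContinuousOn H (Icc 0 l) := by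
    have := intervalIntegral.continuousOn_primitive_interval
      (show IntegrableOn (fun t => V t * y t) (uIcc 0 l) by rwa [uIcc_of_le hl.le])
    rw [uIcc_of_le hl.le] at this
    exact continuousOn_const.add this
  have hyH : ∀ t ∈ Icc 0 l, y t = p + ∫ r in (0 : ℝ)..t, H r := fun t ht => by
    have hss : Icc 0 t ⊆ Icc 0 l := Icc_subset_Icc_right ht.2
    -- Integration by parts against `r` gives `∫ H = t H(t) - ∫ r V y`. This converts the Volterra
    -- equation into `y = p + ∫ H`.
    have key := bilinear_eq_add_integral (ContinuousLinearMap.mul ℝ ℂ) (B := fun r => (r : ℂ))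
      (b := fun _ => 1) ht (fun r _ => Complex.ofRealCLM.hasDerivAt.hasDerivWithinAt)
      continuousOn_const hgi hHeq
    have hi := intervalIntegrable_of_memLp hg ht
    have hi' : IntervalIntegrable (fun r : ℝ => (r : ℂ) * (V r * y r)) volume 0 t :=
      hi.continuousOn_mul (by fun_prop)
    have hHi : IntervalIntegrable H volume 0 t :=
      ContinuousOn.intervalIntegrable (by rw [uIcc_of_le ht.1]; exact hHc.mono hss)
    simp only [ContinuousLinearMap.mul_apply', Complex.ofReal_zero, zero_mul, zero_add, one_mul]
      at key
    rw [intervalIntegral.integral_add hHi hi'] at key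
    rw [hy t ht, add_assoc]
    congr 1
    have e : ∫ r in (0 : ℝ)..t, ((t - r : ℝ) : ℂ) * (V r * y r) =
        t * (∫ r in (0 : ℝ)..t, V r * y r) - ∫ r in (0 : ℝ)..t, (r : ℂ) * (V r * y r) := by
      rw [← intervalIntegral.integral_const_mul, ← intervalIntegral.integral_sub
        (hi.const_mul _) hi']
      refine intervalIntegral.integral_congr fun r _ => ?_
      simp only [Complex.ofReal_sub]
      ring
    have e' : ∫ r in (0 : ℝ)..t, H r = t * H t - ∫ r in (0 : ℝ)..t, (r : ℂ) * (V r * y r) := by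
      rw [key]; ring
    rw [e, e', hH]
    ring
  have hd : ∀ t ∈ Icc 0 l, HasDerivWithinAt y (H t) (Icc 0 l) t := fun t ht => by
    -- Membership as an instance selects the form of the fundamental theorem relative to `Icc 0 l`,
    -- which covers the endpoints too.
    have : Fact (t ∈ Icc 0 l) := ⟨ht⟩
    have h1 : HasDerivWithinAt (fun t => ∫ r in (0 : ℝ)..t, H r) (H t) (Icc 0 l) t :=
      intervalIntegral.integral_hasDerivWithinAt_right
        (ContinuousOn.intervalIntegrable (by
          rw [uIcc_of_le ht.1]; exact hHc.mono (Icc_subset_Icc_right ht.2)))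
        (hHc.stronglyMeasurableAtFilter_nhdsWithin measurableSet_Icc t) (hHc t ht)
    exact (h1.const_add p).congr hyH (hyH t ht)
  obtain ⟨h1, h2, h3⟩ := MemH2.of_hasDerivWithinAt hl hd hg hHeq
  exact ⟨y, h1, by simpa using hy 0 h0, (h2 h0).trans hH0, h3⟩

end initialValue

/-! ### Green's formula and the Wronskian -/

section boundary

variable {l : ℝ} {F : Type*} [NormedAddCommGroup F] [NormedSpace ℝ F] [CompleteSpace F]

/-- Green's formula against a `C²` function. -/
lemma MemH2.green (hl : 0 < l) {f : ℝ → F} (hf : MemH2 l f) {φ φ' φ'' : ℝ → ℝ}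
    (hφ : ∀ t, HasDerivAt φ (φ' t) t) (hφ' : ∀ t, HasDerivAt φ' (φ'' t) t)
    (hφ'' : Continuous φ'') :
    φ l • segDeriv l f l - φ' l • f l - (φ 0 • segDeriv l f 0 - φ' 0 • f 0) =
      ∫ t in (0 : ℝ)..l, (φ t • segDeriv l (segDeriv l f) t - φ'' t • f t) := by
  obtain ⟨h1, -, h2⟩ := hf.segDeriv_segDeriv hl
  have hlm : l ∈ Icc 0 l := ⟨hl.le, le_rfl⟩
  have hφc : Continuous φ := continuous_iff_continuousAt.2 fun t => (hφ t).continuousAt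
  have hφc' : Continuous φ' := continuous_iff_continuousAt.2 fun t => (hφ' t).continuousAt
  have hfc' := hf.continuousOn_segDeriv hl
  -- The product rule is applied to `φ f'` and to `φ' f`; the terms `φ' f'` cancel in the
  -- difference.
  have a1 := bilinear_eq_add_integral (ContinuousLinearMap.lsmul ℝ ℝ (E := F)) hlm
    (fun t _ => (hφ t).hasDerivWithinAt) hφc'.continuousOn (h1.integrable (by norm_num)) h2
  have a2 := bilinear_eq_add_integral (ContinuousLinearMap.lsmul ℝ ℝ (E := F)) hlm
    (fun t _ => (hφ' t).hasDerivWithinAt) hφ''.continuousOn hfc'.integrableOn_Icc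
    (hf.eq_add_integral hl)
  simp only [ContinuousLinearMap.lsmul_apply] at a1 a2
  have i1 : IntervalIntegrable (fun t => φ' t • segDeriv l f t +
      φ t • segDeriv l (segDeriv l f) t) volume 0 l := by
    refine IntervalIntegrable.add (ContinuousOn.intervalIntegrable ?_)
      ((intervalIntegrable_of_memLp h1 hlm).continuousOn_smul hφc.continuousOn)
    rw [uIcc_of_le hl.le]; fun_prop
  have i2 : IntervalIntegrable (fun t => φ'' t • f t + φ' t • segDeriv l f t) volume 0 l := by
    have := hf.continuousOn
    refine ContinuousOn.intervalIntegrable ?_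
    rw [uIcc_of_le hl.le]; fun_prop
  rw [a1, a2]
  have e : ∀ t, φ t • segDeriv l (segDeriv l f) t - φ'' t • f t =
      (φ' t • segDeriv l f t + φ t • segDeriv l (segDeriv l f) t) -
        (φ'' t • f t + φ' t • segDeriv l f t) := fun t => by abel
  simp only [e]
  rw [intervalIntegral.integral_sub i1 i2]
  abel

/-- The Wronskian of two solutions of `y'' = V y` is constant. -/
lemma wronskian_eq (hl : 0 < l) {V y u : ℝ → ℂ} (hy : MemH2 l y) (hu : MemH2 l u)
    (hy2 : segDeriv l (segDeriv l y) =ᵐ[volume.restrict (Icc 0 l)] fun t => V t * y t)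
    (hu2 : segDeriv l (segDeriv l u) =ᵐ[volume.restrict (Icc 0 l)] fun t => V t * u t) :
    y l * segDeriv l u l - u l * segDeriv l y l = y 0 * segDeriv l u 0 - u 0 * segDeriv l y 0 := by
  have a1 := hu.integral_bilinear hl (ContinuousLinearMap.mul ℝ ℂ)
    (fun t ht => hy.hasDerivWithinAt ht) (hy.continuousOn_segDeriv hl)
  have a2 := hy.integral_bilinear hl (ContinuousLinearMap.mul ℝ ℂ)
    (fun t ht => hu.hasDerivWithinAt ht) (hu.continuousOn_segDeriv hl)
  simp only [ContinuousLinearMap.mul_apply'] at a1 a2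
  rw [a1, a2]
  -- The integrands agree because `y u'' = V y u = u y''` almost everywhere.
  have : ∫ t in (0 : ℝ)..l, (segDeriv l y t * segDeriv l u t + y t * segDeriv l (segDeriv l u) t) =
      ∫ t in (0 : ℝ)..l, (segDeriv l u t * segDeriv l y t + u t * segDeriv l (segDeriv l y) t) := by
    refine intervalIntegral.integral_congr_ae ?_
    rw [Filter.EventuallyEq, ae_restrict_iff' measurableSet_Icc] at hy2 hu2
    filter_upwards [hy2, hu2] with t h1 h2 ht
    rw [uIoc_of_le hl.le] at ht
    rw [h1 (Ioc_subset_Icc_self ht), h2 (Ioc_subset_Icc_self ht)]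
    ring
  rw [this]
  ring

end boundary

/-! ### Exponentials of commuting self-adjoint families -/

section gaugeExp

variable {H : Type*} [NormedAddCommGroup H] [InnerProductSpace ℂ H] [CompleteSpace H]

lemma exp_I_smul_zero : NormedSpace.exp (Complex.I • (0 : H →L[ℂ] H)) = 1 := by
  rw [smul_zero, NormedSpace.exp_zero]

/-- The identity commutes with `X`, so a scalar phase splits off. What remains is a one-parameter
group, which can be differentiated even when `φ` is not linear in `t`. -/
lemma exp_I_smul_add (φ t : ℂ) (X : H →L[ℂ] H) :
    NormedSpace.exp (Complex.I • (φ • (1 : H →L[ℂ] H) + t • X)) =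
      Complex.exp (Complex.I * φ) • NormedSpace.exp (t • (Complex.I • X)) := by
  let : NormedAlgebra ℚ (H →L[ℂ] H) := NormedAlgebra.restrictScalars ℚ ℂ _
  rw [smul_add, NormedSpace.exp_add_of_commute
    (((Commute.one_left _).smul_left _).smul_left _)]
  have h1 : NormedSpace.exp (Complex.I • φ • (1 : H →L[ℂ] H)) =
      Complex.exp (Complex.I * φ) • 1 := by
    rw [smul_smul, ← Algebra.algebraMap_eq_smul_one, ← Algebra.algebraMap_eq_smul_one,
      Complex.exp_eq_exp_ℂ, NormedSpace.algebraMap_exp_comm]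
  rw [h1, smul_one_mul, smul_comm Complex.I t X]

lemma hasDerivAt_exp_I_smul_add {φ : ℝ → ℝ} {a t : ℝ} (hφ : HasDerivAt φ a t) (X : H →L[ℂ] H) :
    HasDerivAt (fun t : ℝ => NormedSpace.exp (Complex.I • ((φ t : ℂ) • (1 : H →L[ℂ] H) +
        (t : ℂ) • X)))
      (Complex.I • (((a : ℂ) • (1 : H →L[ℂ] H) + X) *
        NormedSpace.exp (Complex.I • ((φ t : ℂ) • (1 : H →L[ℂ] H) + (t : ℂ) • X)))) t := by
  simp only [exp_I_smul_add]
  have h2 := (hφ.ofReal_comp.const_mul Complex.I).cexp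
  have h3 : HasDerivAt (fun u : ℝ => NormedSpace.exp ((u : ℂ) • (Complex.I • X)))
      ((Complex.I • X) * NormedSpace.exp ((t : ℂ) • (Complex.I • X))) t := by
    have h := HasDerivAt.scomp t (hasDerivAt_exp_smul_const' (𝕂 := ℂ) (Complex.I • X) (t : ℂ))
      Complex.ofRealCLM.hasDerivAt
    refine HasDerivAt.congr_deriv h ?_
    rw [Complex.ofRealCLM_apply, Complex.ofReal_one]
    exact one_smul ℂ _
  refine (h2.smul h3).congr_deriv ?_
  simp only [add_mul, smul_add, mul_smul_comm, smul_mul_assoc, one_mul, smul_smul]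
  rw [add_comm]
  congr 2 <;> ring

/-- `i Y` is skew-adjoint, so the adjoint of its exponential is the exponential of `-i Y`, and the
two exponents commute. -/
lemma exp_I_smul_mem_unitary {Y : H →L[ℂ] H} (hY : star Y = Y) :
    NormedSpace.exp (Complex.I • Y) ∈ unitary (H →L[ℂ] H) := by
  let : NormedAlgebra ℚ (H →L[ℂ] H) := NormedAlgebra.restrictScalars ℚ ℂ _
  have h : star (Complex.I • Y) = -(Complex.I • Y) := by
    rw [star_smul, hY, Complex.star_def, Complex.conj_I, neg_smul]
  have hc : Commute (-(Complex.I • Y)) (Complex.I • Y) := (Commute.refl _).neg_left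
  rw [Unitary.mem_iff, NormedSpace.star_exp, h, ← NormedSpace.exp_add_of_commute hc,
    ← NormedSpace.exp_add_of_commute hc.symm]
  simp

lemma star_real_smul_one_add (φ t : ℝ) {X : H →L[ℂ] H} (hX : star X = X) :
    star ((φ : ℂ) • (1 : H →L[ℂ] H) + (t : ℂ) • X) = (φ : ℂ) • (1 : H →L[ℂ] H) + (t : ℂ) • X := by
  simp [star_add, star_smul, hX]

lemma hasDerivAt_star {B : ℝ → H →L[ℂ] H} {B' : H →L[ℂ] H} {t : ℝ} (hB : HasDerivAt B B' t) :
    HasDerivAt (fun t => star (B t)) (star B') t := hB.star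

lemma continuous_star_comp {B : ℝ → H →L[ℂ] H} (hB : Continuous B) :
    Continuous (fun t => star (B t)) := hB.star

end gaugeExp

/-! ### The gauge transform `Θ` -/

namespace RashbaNetwork

variable (Q : RashbaNetwork) (e : Q.Edge)

lemma contDiff_a : ContDiff ℝ 1 (Q.a e) := by
  have h : ContDiff ℝ 1 fun t : ℝ => Q.A (e.1.1 + t • Q.dir e) :=
    Q.contDiff_A.comp (contDiff_const.add (contDiff_id.smul contDiff_const))
  exact h.inner ℝ contDiff_const

lemma star_σ : star (Q.σ e) = Q.σ e := by
  rw [σ, ← map_star]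
  congr 1
  ext i j
  fin_cases i <;> fin_cases j <;> simp [Matrix.star_apply, sub_eq_add_neg]

lemma hasDerivAt_gauge (t : ℝ) : HasDerivAt (Q.gauge e)
    (((deriv (Q.a e) t : ℝ) : ℂ) • (1 : Spinor →L[ℂ] Spinor)) t := by
  have h : HasDerivAt (Q.a e) (deriv (Q.a e) t) t :=
    ((Q.contDiff_a e).differentiable one_ne_zero t).hasDerivAt
  exact (h.ofReal_comp.smul_const _).add_const _

lemma continuous_gauge : Continuous (Q.gauge e) :=
  continuous_iff_continuousAt.2 fun t => (Q.hasDerivAt_gauge e t).continuousAt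

/-- Only the scalar part of the gauge potential varies along the edge. All values of this integral
thus commute, so `Θ` needs no time ordering. -/
lemma integral_gauge (t : ℝ) : ∫ r in (0 : ℝ)..t, Q.gauge e r =
    ((∫ r in (0 : ℝ)..t, Q.a e r : ℝ) : ℂ) • (1 : Spinor →L[ℂ] Spinor) +
      (t : ℂ) • ((Q.kR : ℂ) • Q.σ e) := by
  have ha := (Q.contDiff_a e).continuous
  have h1 : IntervalIntegrable (fun r => (Q.a e r : ℂ) • (1 : Spinor →L[ℂ] Spinor)) volume 0 t :=
    Continuous.intervalIntegrable (by fun_prop) _ _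
  simp only [gauge]
  rw [intervalIntegral.integral_add h1 intervalIntegrable_const,
    intervalIntegral.integral_smul_const, intervalIntegral.integral_const,
    intervalIntegral.integral_ofReal, sub_zero, ← Complex.coe_smul]

lemma Θ_zero : Q.Θ e 0 = 1 := by
  rw [Θ, intervalIntegral.integral_same]
  exact exp_I_smul_zero

lemma hasDerivAt_Θ (t : ℝ) : HasDerivAt (Q.Θ e) (Complex.I • (Q.gauge e t * Q.Θ e t)) t := by
  have h1 : HasDerivAt (fun t => ∫ r in (0 : ℝ)..t, Q.a e r) (Q.a e t) t :=
    ((Q.contDiff_a e).continuous.integral_hasStrictDerivAt 0 t).hasDerivAt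
  have h2 := hasDerivAt_exp_I_smul_add h1 ((Q.kR : ℂ) • Q.σ e)
  have h3 : Q.Θ e = fun t : ℝ => NormedSpace.exp (Complex.I •
      (((∫ r in (0 : ℝ)..t, Q.a e r : ℝ) : ℂ) • (1 : Spinor →L[ℂ] Spinor) +
        (t : ℂ) • ((Q.kR : ℂ) • Q.σ e))) := by
    funext t
    rw [Θ, integral_gauge]
  rw [h3]
  exact h2

lemma Θ_mem_unitary (t : ℝ) : Q.Θ e t ∈ unitary (Spinor →L[ℂ] Spinor) := by
  refine exp_I_smul_mem_unitary ?_
  have h := star_real_smul_one_add (∫ r in (0 : ℝ)..t, Q.a e r) (t * Q.kR) (Q.star_σ e)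
  rw [integral_gauge, smul_smul, ← Complex.ofReal_mul]
  exact h

lemma Θ_star_apply (t : ℝ) (v : Spinor) : Q.Θ e t (star (Q.Θ e t) v) = v :=
  congrArg (fun T : Spinor →L[ℂ] Spinor => T v) (Unitary.mem_iff.1 (Q.Θ_mem_unitary e t)).2

lemma star_Θ_apply (t : ℝ) (v : Spinor) : star (Q.Θ e t) (Q.Θ e t v) = v :=
  congrArg (fun T : Spinor →L[ℂ] Spinor => T v) (Unitary.mem_iff.1 (Q.Θ_mem_unitary e t)).1

lemma norm_Θ_apply (t : ℝ) (v : Spinor) : ‖Q.Θ e t v‖ = ‖v‖ :=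
  ContinuousLinearMap.norm_map_of_mem_unitary (Q.Θ_mem_unitary e t) v

lemma norm_star_Θ_apply (t : ℝ) (v : Spinor) : ‖star (Q.Θ e t) v‖ = ‖v‖ := by
  rw [← Q.norm_Θ_apply e t, Q.Θ_star_apply]

/-- Application of an operator to a spinor, as a real bilinear map. -/
def applyBilin : (Spinor →L[ℂ] Spinor) →L[ℝ] Spinor →L[ℝ] Spinor :=
  ContinuousLinearMap.restrictScalarsL ℂ Spinor Spinor ℝ ℝ

lemma applyBilin_apply (T : Spinor →L[ℂ] Spinor) (v : Spinor) : applyBilin T v = T v := rfl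

lemma continuous_Θ : Continuous (Q.Θ e) :=
  continuous_iff_continuousAt.2 fun t => (Q.hasDerivAt_Θ e t).continuousAt

/-- `A ∈ C¹` makes `Θ` of class `C²`, as `MemH2.bilinear` requires of the factor multiplying an `H²`
function. -/
lemma exists_hasDerivAt_deriv_Θ : ∃ B : ℝ → Spinor →L[ℂ] Spinor, Continuous B ∧
    ∀ t, HasDerivAt (fun t => Complex.I • (Q.gauge e t * Q.Θ e t)) (B t) t := by
  refine ⟨_, ?_, fun t => ((Q.hasDerivAt_gauge e t).mul (Q.hasDerivAt_Θ e t)).const_smul Complex.I⟩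
  have h1 := Q.continuous_gauge e
  have h2 := Q.continuous_Θ e
  have h3 : Continuous (deriv (Q.a e)) := (Q.contDiff_a e).continuous_deriv le_rfl
  fun_prop

variable {e}

lemma memH2_Θ {g : ℝ → Spinor} (hg : MemH2 (Q.len e) g) :
    MemH2 (Q.len e) (fun t => Q.Θ e t (g t)) ∧
    ∀ t ∈ Icc 0 (Q.len e), segDeriv (Q.len e) (fun t => Q.Θ e t (g t)) t =
      Complex.I • Q.gauge e t (Q.Θ e t (g t)) + Q.Θ e t (segDeriv (Q.len e) g t) := by
  obtain ⟨B, hB, hB'⟩ := Q.exists_hasDerivAt_deriv_Θ e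
  exact MemH2.bilinear (Q.len_pos e) applyBilin
    (fun t _ => (Q.hasDerivAt_Θ e t).hasDerivWithinAt) (fun t _ => (hB' t).hasDerivWithinAt)
    hB.continuousOn hg

lemma memH2_star_Θ {f : ℝ → Spinor} (hf : MemH2 (Q.len e) f) :
    MemH2 (Q.len e) (fun t => star (Q.Θ e t) (f t)) := by
  obtain ⟨B, hB, hB'⟩ := Q.exists_hasDerivAt_deriv_Θ e
  exact (MemH2.bilinear (Q.len_pos e) applyBilin
    (fun t _ => (hasDerivAt_star (Q.hasDerivAt_Θ e t)).hasDerivWithinAt)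
    (fun t _ => (hasDerivAt_star (hB' t)).hasDerivWithinAt) (continuous_star_comp hB).continuousOn hf).1

lemma covDeriv_Θ {g : ℝ → Spinor} (hg : MemH2 (Q.len e) g) {t : ℝ}
    (ht : t ∈ Icc 0 (Q.len e)) :
    Q.covDeriv e (fun t => Q.Θ e t (g t)) t = Q.Θ e t (segDeriv (Q.len e) g t) := by
  rw [covDeriv, (Q.memH2_Θ hg).2 t ht, add_sub_cancel_left]

/-- The derivative of `Θ` contributes `i · i = -1` times the gauge term, cancelling it.
Differentiability is required only at `t`, because the second application is to `i g'`, which is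
differentiable only almost everywhere. -/
lemma momentum_Θ {g : ℝ → Spinor} {t : ℝ} (ht : t ∈ Icc 0 (Q.len e))
    (hg : DifferentiableWithinAt ℝ g (Icc 0 (Q.len e)) t) :
    Q.momentum e (fun t => Q.Θ e t (g t)) t = Complex.I • Q.Θ e t (segDeriv (Q.len e) g t) := by
  have h := applyBilin.hasFDerivWithinAt_of_bilinear
    (Q.hasDerivAt_Θ e t).hasFDerivAt.hasFDerivWithinAt hg.hasDerivWithinAt.hasFDerivWithinAt
  have h' : HasDerivWithinAt (fun t => Q.Θ e t (g t))
      (Complex.I • Q.gauge e t (Q.Θ e t (g t)) + Q.Θ e t (segDeriv (Q.len e) g t))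
      (Icc 0 (Q.len e)) t := by
    refine h.hasDerivWithinAt.congr_deriv ?_
    simp [applyBilin_apply, segDeriv, add_comm]
  rw [momentum, segDeriv_eq (Q.len_pos e) ht h', smul_add, smul_smul, Complex.I_mul_I]
  simp

/-- The gauge transform turns the differential expression on an edge into a Schrödinger one. -/
lemma edgeOp_Θ {g : ℝ → Spinor} (hg : MemH2 (Q.len e) g) :
    Q.edgeOp e (fun t => Q.Θ e t (g t)) =ᵐ[Q.edgeMeasure e] fun t =>
      Q.Θ e t (((Q.U e t - Q.kR ^ 2 : ℝ) : ℂ) • g t -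
        segDeriv (Q.len e) (segDeriv (Q.len e) g) t) := by
  filter_upwards [(hg.segDeriv_segDeriv (Q.len_pos e)).2.1, ae_restrict_mem measurableSet_Icc]
    with t h1 ht
  have h2 : EqOn (Q.momentum e fun t => Q.Θ e t (g t))
      (fun t => Q.Θ e t ((Complex.I • segDeriv (Q.len e) g) t)) (Icc 0 (Q.len e)) := fun r hr => by
    rw [Q.momentum_Θ hr (hg.1 r hr)]
    exact (map_smul (Q.Θ e r) _ _).symm
  rw [edgeOp, Q.momentum_congr e h2 ht,
    Q.momentum_Θ ht (h1.differentiableWithinAt.const_smul Complex.I),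
    segDeriv_smul _ h1.differentiableWithinAt, map_smul, smul_smul, Complex.I_mul_I, map_sub,
    map_smul]
  module

end RashbaNetwork

/-! ### The equation `f'' = V f` with values in a vector space -/

section hill

variable {F : Type*} [NormedAddCommGroup F] [NormedSpace ℂ F] [CompleteSpace F] {l : ℝ}
  {V : ℝ → ℂ}

/-- `f ∈ H²[0, l]` solves `f'' = V f` almost everywhere. -/
def IsHillSolution (l : ℝ) (V : ℝ → ℂ) (f : ℝ → F) : Prop :=
  MemH2 l f ∧ segDeriv l (segDeriv l f) =ᵐ[volume.restrict (Icc 0 l)] fun t => V t • f t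

lemma MemH2.segDeriv_segDeriv_add (hl : 0 < l) {f g : ℝ → F} (hf : MemH2 l f) (hg : MemH2 l g) :
    segDeriv l (segDeriv l (f + g)) =ᵐ[volume.restrict (Icc 0 l)]
      segDeriv l (segDeriv l f) + segDeriv l (segDeriv l g) := by
  filter_upwards [(hf.segDeriv_segDeriv hl).2.1, (hg.segDeriv_segDeriv hl).2.1,
    ae_restrict_mem measurableSet_Icc] with t h1 h2 ht
  have h : EqOn (segDeriv l (f + g)) (segDeriv l f + segDeriv l g) (Icc 0 l) :=
    fun r hr => segDeriv_add (hf.1 r hr) (hg.1 r hr)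
  rw [segDeriv_congr h ht, segDeriv_add h1.differentiableWithinAt h2.differentiableWithinAt]
  rfl

lemma IsHillSolution.add (hl : 0 < l) {f g : ℝ → F} (hf : IsHillSolution l V f)
    (hg : IsHillSolution l V g) : IsHillSolution l V (f + g) := by
  refine ⟨hf.1.add hg.1, ?_⟩
  filter_upwards [hf.1.segDeriv_segDeriv_add hl hg.1, hf.2, hg.2] with t h h1 h2
  rw [h, Pi.add_apply, Pi.add_apply, h1, h2, smul_add]

lemma IsHillSolution.smul (hl : 0 < l) {f : ℝ → F} (hf : IsHillSolution l V f) (k : ℂ) :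
    IsHillSolution l V (k • f) := by
  refine ⟨hf.1.smul k, ?_⟩
  filter_upwards [(hf.1.segDeriv_segDeriv hl).2.1, hf.2, ae_restrict_mem measurableSet_Icc]
    with t h1 h2 ht
  have h : EqOn (segDeriv l (k • f)) (k • segDeriv l f) (Icc 0 l) :=
    fun r hr => segDeriv_smul k (hf.1.1 r hr)
  rw [segDeriv_congr h ht, segDeriv_smul k h1.differentiableWithinAt, h2, Pi.smul_apply,
    smul_comm]

/-- Carries the scalar solutions `s` and `c` over to spinor-valued ones. -/
lemma IsHillSolution.smul_const (hl : 0 < l) {y : ℝ → ℂ} (hy : IsHillSolution l V y) (v : F) :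
    IsHillSolution l V (fun t => y t • v) := by
  obtain ⟨h1, h2, h3⟩ := hy.1.segDeriv_segDeriv hl
  have hi : ∀ t ∈ Icc 0 l, segDeriv l y t • v =
      segDeriv l y 0 • v + ∫ s in (0 : ℝ)..t, segDeriv l (segDeriv l y) s • v := fun t ht => by
    rw [h3 t ht, intervalIntegral.integral_smul_const, add_smul]
  have hm : MemLp (fun t => segDeriv l (segDeriv l y) t • v) 2 (volume.restrict (Icc 0 l)) := by
    refine h1.of_le_mul (c := ‖v‖) (h1.1.smul_const v) (Filter.Eventually.of_forall fun t => ?_)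
    rw [norm_smul, mul_comm]
  obtain ⟨h4, -, h5⟩ := MemH2.of_hasDerivWithinAt hl
    (fun t ht => (hy.1.hasDerivWithinAt ht).smul_const v) hm hi
  refine ⟨h4, ?_⟩
  filter_upwards [h5, hy.2] with t h6 h7
  rw [h6, h7, smul_eq_mul, mul_smul]

/-- Supplies the interpolant that reduces arbitrary end values to zero end values. -/
lemma memH2_affine (hl : 0 < l) (p q : F) : MemH2 l (fun t : ℝ => p + (t : ℂ) • q) ∧
    segDeriv l (segDeriv l (fun t : ℝ => p + (t : ℂ) • q)) =ᵐ[volume.restrict (Icc 0 l)] 0 := by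
  have h : ∀ t ∈ Icc 0 l, HasDerivWithinAt (fun t : ℝ => p + (t : ℂ) • q) q (Icc 0 l) t :=
    fun t _ => by
      have := ((Complex.ofRealCLM.hasDerivAt (x := t)).smul_const q).const_add p
      simpa using this.hasDerivWithinAt
  obtain ⟨h1, -, h2⟩ := MemH2.of_hasDerivWithinAt (g := 0) hl h MemLp.zero (by simp)
  exact ⟨h1, h2⟩

end hill

/-! ### `L²` norms on an edge and the Dirichlet resolvent -/

namespace RashbaNetwork

variable (Q : RashbaNetwork)

section edgeNorm

variable (e : Q.Edge) {F G : Type*} [NormedAddCommGroup F] [NormedAddCommGroup G]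

/-- The `L²` norm on an edge. -/
def edgeNorm (f : ℝ → F) : ℝ := (eLpNorm f 2 (Q.edgeMeasure e)).toReal

lemma edgeNorm_nonneg (f : ℝ → F) : 0 ≤ Q.edgeNorm e f := ENNReal.toReal_nonneg

variable {e}

lemma edgeNorm_add_le {f g : ℝ → F} (hf : MemLp f 2 (Q.edgeMeasure e))
    (hg : MemLp g 2 (Q.edgeMeasure e)) :
    Q.edgeNorm e (f + g) ≤ Q.edgeNorm e f + Q.edgeNorm e g := by
  rw [edgeNorm, edgeNorm, edgeNorm, ← ENNReal.toReal_add hf.2.ne hg.2.ne]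
  exact ENNReal.toReal_mono (ENNReal.add_ne_top.2 ⟨hf.2.ne, hg.2.ne⟩)
    (eLpNorm_add_le hf.1 hg.1 (by norm_num))

lemma edgeNorm_congr_norm {f : ℝ → F} {g : ℝ → G}
    (h : ∀ t ∈ Icc 0 (Q.len e), ‖f t‖ = ‖g t‖) : Q.edgeNorm e f = Q.edgeNorm e g := by
  rw [edgeNorm, edgeNorm]
  congr 1
  refine eLpNorm_congr_norm_ae ?_
  filter_upwards [ae_restrict_mem measurableSet_Icc] with t ht using h t ht

/-- The bound can fail without `hg`: `toReal` sends an infinite norm of `g` to `0`. -/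
lemma edgeNorm_le_mul {f : ℝ → F} {g : ℝ → G} {C : ℝ} (hC : 0 ≤ C)
    (hg : MemLp g 2 (Q.edgeMeasure e)) (h : ∀ t ∈ Icc 0 (Q.len e), ‖f t‖ ≤ C * ‖g t‖) :
    Q.edgeNorm e f ≤ C * Q.edgeNorm e g := by
  have h1 : eLpNorm f 2 (Q.edgeMeasure e) ≤ ENNReal.ofReal C * eLpNorm g 2 (Q.edgeMeasure e) := by
    refine eLpNorm_le_mul_eLpNorm_of_ae_le_mul ?_ 2
    filter_upwards [ae_restrict_mem measurableSet_Icc] with t ht using h t ht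
  have h2 := ENNReal.toReal_mono (ENNReal.mul_ne_top ENNReal.ofReal_ne_top hg.2.ne) h1
  rwa [ENNReal.toReal_mul, ENNReal.toReal_ofReal hC] at h2

lemma edgeNorm_le_add {f : ℝ → F} {g : ℝ → G} {p q : ℝ} (hp : 0 ≤ p) (hq : 0 ≤ q)
    (hg : MemLp g 2 (Q.edgeMeasure e)) (h : ∀ t ∈ Icc 0 (Q.len e), ‖f t‖ ≤ p * ‖g t‖ + q) :
    Q.edgeNorm e f ≤ p * Q.edgeNorm e g + q * Q.edgeNorm e (1 : ℝ → ℝ) := by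
  have h1 : MemLp (1 : ℝ → ℝ) 2 (Q.edgeMeasure e) :=
    memLp_of_continuousOn (l := Q.len e) continuousOn_const 2
  have hm1 : MemLp (fun t => p * ‖g t‖) 2 (Q.edgeMeasure e) := hg.norm.const_mul p
  have hm2 : MemLp (fun _ : ℝ => q) 2 (Q.edgeMeasure e) :=
    memLp_of_continuousOn (l := Q.len e) continuousOn_const 2
  calc Q.edgeNorm e f ≤ 1 * Q.edgeNorm e ((fun t => p * ‖g t‖) + fun _ => q) := by
        refine Q.edgeNorm_le_mul zero_le_one (hm1.add hm2) fun t ht => ?_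
        rw [one_mul, Pi.add_apply, Real.norm_of_nonneg (by positivity)]
        exact h t ht
    _ ≤ Q.edgeNorm e (fun t => p * ‖g t‖) + Q.edgeNorm e (fun _ : ℝ => q) := by
        rw [one_mul]
        exact Q.edgeNorm_add_le hm1 hm2
    _ ≤ _ := by
        gcongr
        · exact Q.edgeNorm_le_mul hp hg fun t _ => by simp [abs_of_nonneg hp]
        · exact Q.edgeNorm_le_mul hq h1 fun t _ => by simp [abs_of_nonneg hq]

/-- Hölder's inequality with exponents 2 and 2. -/
lemma norm_integral_smul_le [NormedSpace ℂ F] {ψ : ℝ → ℂ} {g : ℝ → F}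
    (hψ : MemLp ψ 2 (Q.edgeMeasure e)) (hg : MemLp g 2 (Q.edgeMeasure e)) :
    ‖∫ t in (0 : ℝ)..(Q.len e), ψ t • g t‖ ≤ Q.edgeNorm e ψ * Q.edgeNorm e g := by
  rw [intervalIntegral.integral_of_le (Q.len_pos e).le, ← integral_Icc_eq_integral_Ioc]
  have h1 : ‖∫ t in Icc 0 (Q.len e), ψ t • g t‖ₑ ≤
      eLpNorm (ψ • g) 1 (Q.edgeMeasure e) := by
    rw [eLpNorm_one_eq_lintegral_enorm]
    exact enorm_integral_le_lintegral_enorm _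
  have h2 : eLpNorm (ψ • g) 1 (Q.edgeMeasure e) ≤
      eLpNorm ψ 2 (Q.edgeMeasure e) * eLpNorm g 2 (Q.edgeMeasure e) :=
    eLpNorm_smul_le_mul_eLpNorm hg.1 hψ.1
  have h3 := ENNReal.toReal_mono (ENNReal.mul_ne_top hψ.2.ne hg.2.ne) (h1.trans h2)
  rwa [ENNReal.toReal_mul, toReal_enorm] at h3

lemma eqOn_zero_of_edgeNorm_eq_zero {f : ℝ → F} (hf : ContinuousOn f (Icc 0 (Q.len e)))
    (h : Q.edgeNorm e f = 0) : EqOn f 0 (Icc 0 (Q.len e)) := by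
  have hm : MemLp f 2 (Q.edgeMeasure e) := memLp_of_continuousOn hf 2
  have h1 : eLpNorm f 2 (Q.edgeMeasure e) = 0 :=
    ((ENNReal.toReal_eq_zero_iff _).1 h).resolve_right hm.2.ne
  exact Measure.eqOn_Icc_of_ae_eq volume (Q.len_pos e).ne
    ((eLpNorm_eq_zero_iff hm.1 (by norm_num)).1 h1) hf continuousOn_const

end edgeNorm

/-- the coefficient `U - z` of the Schrödinger equation `y'' = (U - z) y` on an edge -/
def potential (e : Q.Edge) (z : ℂ) (t : ℝ) : ℂ := (Q.U e t : ℂ) - z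

lemma memLp_potential (e : Q.Edge) (z : ℂ) : MemLp (Q.potential e z) 2 (Q.edgeMeasure e) :=
  (Q.memLp_U e).ofReal.sub (memLp_of_continuousOn (l := Q.len e) continuousOn_const 2)

lemma exists_edgeNorm_one_le : ∃ K : ℝ, 0 ≤ K ∧ ∀ e, Q.edgeNorm e (1 : ℝ → ℝ) ≤ K := by
  obtain ⟨a, b, ha, hab⟩ := Q.length_bounds
  refine ⟨(ENNReal.ofReal b ^ (1 / 2 : ℝ)).toReal, ENNReal.toReal_nonneg, fun e => ?_⟩
  have h : eLpNorm (1 : ℝ → ℝ) 2 (Q.edgeMeasure e) ≤ ENNReal.ofReal b ^ (1 / 2 : ℝ) := by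
    have h1 : eLpNorm (fun _ : ℝ => (1 : ℝ)) 2 (Q.edgeMeasure e) =
        ENNReal.ofReal (Q.len e) ^ (1 / 2 : ℝ) := by
      rw [eLpNorm_const' _ (by norm_num) (by norm_num)]
      simp [edgeMeasure]
    refine h1.le.trans ?_
    gcongr
    exact (hab e.1 e.2).2
  exact ENNReal.toReal_mono (by simp) h

lemma exists_edgeNorm_potential_le (z : ℂ) :
    ∃ K : ℝ, 0 ≤ K ∧ ∀ e, Q.edgeNorm e (Q.potential e z) ≤ K := by
  obtain ⟨K, hK, h1⟩ := Q.exists_edgeNorm_one_le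
  obtain ⟨C, hC⟩ := Q.bounded_U
  -- `ENNReal.ofReal` truncates a negative `C` to `0`, hence the maximum.
  refine ⟨max C 0 + ‖z‖ * K, by positivity, fun e => ?_⟩
  calc Q.edgeNorm e (Q.potential e z)
      ≤ 1 * Q.edgeNorm e (Q.U e) + ‖z‖ * Q.edgeNorm e (1 : ℝ → ℝ) := by
        refine Q.edgeNorm_le_add zero_le_one (norm_nonneg z) (Q.memLp_U e) fun t _ => ?_
        rw [one_mul, ← Complex.norm_real]
        exact norm_sub_le _ _
    _ ≤ _ := by
        rw [one_mul]
        gcongr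
        · refine (ENNReal.toReal_mono ENNReal.ofReal_ne_top (hC e)).trans ?_
          rw [ENNReal.toReal_ofReal']
        · exact h1 e

open Classical in
lemma represents_single {e : Q.Edge} {F : ℝ → Spinor} (hF : MemLp F 2 (Q.edgeMeasure e)) :
    Q.Represents (Pi.single e F) (lp.single 2 e (hF.toLp F)) := by
  intro e'
  rcases eq_or_ne e' e with rfl | h
  · rw [lp.single_apply_self, Pi.single_eq_same]
    exact hF.coeFn_toLp
  · rw [lp.single_apply_ne _ _ _ h, Pi.single_eq_of_ne h]
    exact Lp.coeFn_zero _ _ _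

/-- A priori bound for the Dirichlet problem on a single edge, uniform in the edge. -/
lemma exists_dirichlet_bound {E : ℂ} (hE : E ∉ Q.dirichletOp.unboundedSpectrum) :
    ∃ C : ℝ, 0 ≤ C ∧ ∀ (e : Q.Edge) (F h : ℝ → Spinor), MemH2 (Q.len e) F → F 0 = 0 →
      F (Q.len e) = 0 → MemLp h 2 (Q.edgeMeasure e) →
      Q.edgeOp e F =ᵐ[Q.edgeMeasure e] E • F + h → Q.edgeNorm e F ≤ C * Q.edgeNorm e h := by
  classical
  -- Only the left inverse property `R (D - E) = 1` is used. The constant `‖R‖` does not depend on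
  -- the edge.
  obtain ⟨R, hR, -⟩ := not_not.1 hE
  refine ⟨‖R‖, norm_nonneg R, fun e F h hF h0 hl hh hEq => ?_⟩
  have hFm : MemLp F 2 (Q.edgeMeasure e) := memLp_of_continuousOn hF.continuousOn 2
  have hH2 : ∀ e', MemH2 (Q.len e') (Pi.single (M := fun _ => ℝ → Spinor) e F e') := fun e' => by
    rcases eq_or_ne e' e with rfl | h'
    · rwa [Pi.single_eq_same]
    · rw [Pi.single_eq_of_ne h']
      exact MemH2.zero
  set u : Q.StateSpace := lp.single 2 e (hFm.toLp F) with hu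
  set w : Q.StateSpace := lp.single 2 e (hh.toLp h) with hw
  -- Extension by zero to the other edges makes `F` a state in the domain of `D` with `(D - E) u =
  -- w`. Then `u = R w`, and the norms of `u` and `w` are those on the single edge.
  have hgraph : (u, E • u + w) ∈ Q.maximalGraph := by
    refine ⟨Pi.single e F, hH2, Q.represents_single hFm, fun e' => ?_⟩
    refine ((((Q.represents_single hFm).smul E).add (Q.represents_single hh)) e').trans ?_
    rcases eq_or_ne e' e with rfl | h'
    · simp only [Pi.add_apply, Pi.smul_apply, Pi.single_eq_same]
      exact hEq.symm
    · simp only [Pi.add_apply, Pi.smul_apply, Pi.single_eq_of_ne h', smul_zero, add_zero]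
      exact (Q.edgeOp_zero e').symm
  rw [← graph_maximalOp, LinearPMap.mem_graph_iff] at hgraph
  obtain ⟨y, hy1, hy2⟩ := hgraph
  have hdir : u ∈ Q.dirichletDomain := by
    refine ⟨Pi.single e F, hH2, Q.represents_single hFm, fun e' => ?_⟩
    rcases eq_or_ne e' e with rfl | h'
    · rw [Pi.single_eq_same]
      exact ⟨h0, hl⟩
    · rw [Pi.single_eq_of_ne h']
      exact ⟨rfl, rfl⟩
  simp only at hy1 hy2
  let x : Q.dirichletOp.domain := ⟨u, hdir, hy1 ▸ y.2⟩
  have hxy : Q.dirichletOp x = Q.maximalOp y := LinearPMap.domRestrict_apply hy1.symm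
  have hx : Q.dirichletOp x = E • u + w := hxy.trans hy2
  have hRx := hR x
  rw [hx] at hRx
  have hRw : R w = u := by
    have : E • u + w - E • (x : Q.StateSpace) = w := add_sub_cancel_left _ _
    rwa [this] at hRx
  have hnorm := R.le_opNorm w
  rw [hRw, hu, hw, lp.norm_single (by norm_num), lp.norm_single (by norm_num), Lp.norm_toLp,
    Lp.norm_toLp] at hnorm
  exact hnorm

end RashbaNetwork

/-! ### Two-sided estimates between solutions and their end values -/

namespace RashbaNetwork

variable (Q : RashbaNetwork)

lemma edgeNorm_Θ {e : Q.Edge} (g : ℝ → Spinor) :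
    Q.edgeNorm e (fun t => Q.Θ e t (g t)) = Q.edgeNorm e g :=
  Q.edgeNorm_congr_norm fun t _ => Q.norm_Θ_apply e t (g t)

lemma memLp_Θ {e : Q.Edge} {g : ℝ → Spinor} (hg : MemLp g 2 (Q.edgeMeasure e)) :
    MemLp (fun t => Q.Θ e t (g t)) 2 (Q.edgeMeasure e) :=
  MemLp.bilinear_of_continuousOn applyBilin (Q.continuous_Θ e).continuousOn hg

/-- Off the Dirichlet spectrum, solutions on an edge are controlled by their boundary values. -/
lemma exists_solution_bound {E z : ℂ} (hE : E ∉ Q.dirichletOp.unboundedSpectrum)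
    (hz : z = E + (Q.kR : ℂ) ^ 2) :
    ∃ C : ℝ, 0 ≤ C ∧ ∀ (e : Q.Edge) (g : ℝ → Spinor),
      IsHillSolution (Q.len e) (Q.potential e z) g →
      Q.edgeNorm e g ≤ C * (‖g 0‖ + ‖g (Q.len e)‖) := by
  obtain ⟨C, hC, hD⟩ := Q.exists_dirichlet_bound hE
  obtain ⟨K, hK, hV⟩ := Q.exists_edgeNorm_potential_le z
  obtain ⟨K₁, hK₁, h1⟩ := Q.exists_edgeNorm_one_le
  refine ⟨C * K + K₁, by positivity, fun e g hg => ?_⟩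
  have hl := Q.len_pos e
  have hlc : (Q.len e : ℂ) ≠ 0 := by exact_mod_cast hl.ne'
  set M := ‖g 0‖ + ‖g (Q.len e)‖ with hM
  have hM0 : 0 ≤ M := by positivity
  -- `η` is the affine function with the end values of `g`; on the segment its values are convex
  -- combinations of them. The difference `w = g - η` satisfies Dirichlet conditions.
  set η : ℝ → Spinor := fun t => g 0 + (t : ℂ) • ((Q.len e : ℂ)⁻¹ • (g (Q.len e) - g 0)) with hη
  obtain ⟨hη1, hη2⟩ := memH2_affine hl (g 0) ((Q.len e : ℂ)⁻¹ • (g (Q.len e) - g 0))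
  change MemH2 _ η at hη1
  change segDeriv _ (segDeriv _ η) =ᵐ[_] _ at hη2
  have hη0 : η 0 = g 0 := by simp [hη]
  have hηl : η (Q.len e) = g (Q.len e) := by simp [hη, smul_smul, hlc]
  have hηM : ∀ t ∈ Icc 0 (Q.len e), ‖η t‖ ≤ M := fun t ht => by
    have e1 : η t = ((1 - t / Q.len e : ℝ) : ℂ) • g 0 + ((t / Q.len e : ℝ) : ℂ) • g (Q.len e) := by
      simp only [hη, smul_smul, smul_sub]
      push_cast
      rw [div_eq_mul_inv]
      module
    have h2 : 0 ≤ t / Q.len e := div_nonneg ht.1 hl.le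
    have h3 : t / Q.len e ≤ 1 := (div_le_one hl).2 ht.2
    rw [e1]
    refine (norm_add_le _ _).trans ?_
    rw [norm_smul, norm_smul, Complex.norm_real, Complex.norm_real, Real.norm_of_nonneg h2,
      Real.norm_of_nonneg (by linarith)]
    nlinarith [norm_nonneg (g 0), norm_nonneg (g (Q.len e))]
  have hηm : MemLp η 2 (Q.edgeMeasure e) := memLp_of_continuousOn hη1.continuousOn 2
  set w : ℝ → Spinor := g + (-1 : ℂ) • η with hw
  have hηn : MemH2 (Q.len e) ((-1 : ℂ) • η) := hη1.smul (-1)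
  have hw1 : MemH2 (Q.len e) w := hg.1.add hηn
  set V := Q.potential e z with hVdef
  have hVη : MemLp (fun t => V t • η t) 2 (Q.edgeMeasure e) := by
    have := MemLp.bilinear_of_continuousOn (ContinuousLinearMap.lsmul ℝ ℂ (E := Spinor)).flip
      hη1.continuousOn (Q.memLp_potential e z)
    exact this
  have hneg : segDeriv (Q.len e) (segDeriv (Q.len e) ((-1 : ℂ) • η)) =ᵐ[Q.edgeMeasure e] 0 := by
    have h0 : IsHillSolution (Q.len e) 0 η := ⟨hη1, hη2.trans (by simp; rfl)⟩
    exact (h0.smul hl (-1)).2.trans (by simp; rfl)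
  -- As `η'' = 0`, we have `w'' = V g = V w + V η`, so `Θ w` solves the Dirichlet problem with
  -- right-hand side `-Θ (V η)`, whose norm is at most `M ‖V‖`.
  have hop : Q.edgeOp e (fun t => Q.Θ e t (w t)) =ᵐ[Q.edgeMeasure e]
      E • (fun t => Q.Θ e t (w t)) + fun t => Q.Θ e t (-(V t • η t)) := by
    filter_upwards [Q.edgeOp_Θ hw1, hg.1.segDeriv_segDeriv_add hl hηn, hg.2, hneg]
      with t a1 a2 a3 a4
    rw [a1, a2, Pi.add_apply, Pi.add_apply, Pi.smul_apply, a3, a4, ← map_smul, ← map_add]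
    congr 1
    simp only [hw, Pi.add_apply, Pi.smul_apply, Pi.zero_apply, hVdef, potential, hz]
    push_cast
    module
  have hb := hD e _ _ (Q.memH2_Θ hw1).1 (by simp [hw, hη0]) (by simp [hw, hηl])
    (Q.memLp_Θ hVη.neg) hop
  have hbV : Q.edgeNorm e (fun t => Q.Θ e t (-(V t • η t))) ≤ M * Q.edgeNorm e V := by
    refine Q.edgeNorm_le_mul hM0 (Q.memLp_potential e z) fun t ht => ?_
    rw [norm_Θ_apply, norm_neg, norm_smul, mul_comm]
    gcongr
    exact hηM t ht
  have hbη : Q.edgeNorm e η ≤ M * Q.edgeNorm e (1 : ℝ → ℝ) := by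
    refine Q.edgeNorm_le_mul hM0 (memLp_of_continuousOn (l := Q.len e) continuousOn_const 2)
      fun t ht => ?_
    simpa using hηM t ht
  have hsum : g = w + η := by
    rw [hw]; module
  rw [edgeNorm_Θ] at hb
  calc Q.edgeNorm e g = Q.edgeNorm e (w + η) := by rw [← hsum]
    _ ≤ Q.edgeNorm e w + Q.edgeNorm e η :=
        Q.edgeNorm_add_le (memLp_of_continuousOn hw1.continuousOn 2) hηm
    _ ≤ C * (M * K) + M * K₁ := by
        gcongr
        · exact hb.trans (by gcongr; exact hbV.trans (by gcongr; exact hV e))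
        · exact hbη.trans (by gcongr; exact h1 e)
    _ = _ := by ring

/-- Boundary values of solutions on an edge are controlled by the `L²` norm. -/
lemma exists_boundary_bound (z : ℂ) :
    ∃ C : ℝ, 0 ≤ C ∧ ∀ (e : Q.Edge) (g : ℝ → Spinor),
      IsHillSolution (Q.len e) (Q.potential e z) g →
      ‖g 0‖ ≤ C * Q.edgeNorm e g ∧ ‖g (Q.len e)‖ ≤ C * Q.edgeNorm e g := by
  obtain ⟨K, hK, hV⟩ := Q.exists_edgeNorm_potential_le z
  obtain ⟨K₁, hK₁, h1⟩ := Q.exists_edgeNorm_one_le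
  obtain ⟨a, b, ha, hab⟩ := Q.length_bounds
  refine ⟨|b| * K + 10 / a * K₁, by positivity, fun e g hg => ?_⟩
  set l := Q.len e with hldef
  have hl : 0 < l := Q.len_pos e
  have hal : a ≤ l := (hab e.1 e.2).1
  have hlb : l ≤ |b| := (hab e.1 e.2).2.trans (le_abs_self b)
  -- Since `g'' = V g`, the integral in Green's formula is that of `(φ V - φ'') g`, to which Hölder
  -- applies. The bounds on `l` make the constant independent of the edge; 10 is a generous value,
  -- as `4 / l` already bounds `φ''` for both cubics below.
  have key : ∀ φ φ'' : ℝ → ℝ, Continuous φ → Continuous φ'' →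
      (∀ t ∈ Icc 0 l, |φ t| ≤ l) → (∀ t ∈ Icc 0 l, |φ'' t| ≤ 10 / l) →
      ‖∫ t in (0 : ℝ)..l, (φ t • segDeriv l (segDeriv l g) t - φ'' t • g t)‖ ≤
        (|b| * K + 10 / a * K₁) * Q.edgeNorm e g := fun φ φ'' hφ hφ'' hb hb'' => by
    set ψ : ℝ → ℂ := fun t => (φ t : ℂ) * Q.potential e z t - (φ'' t : ℂ) with hψ
    have e1 : ∫ t in (0 : ℝ)..l, (φ t • segDeriv l (segDeriv l g) t - φ'' t • g t) =
        ∫ t in (0 : ℝ)..l, ψ t • g t := by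
      refine intervalIntegral.integral_congr_ae ?_
      have h2 := hg.2
      rw [Filter.EventuallyEq, ae_restrict_iff' measurableSet_Icc] at h2
      filter_upwards [h2] with t h3 ht
      rw [uIoc_of_le hl.le] at ht
      rw [h3 (Ioc_subset_Icc_self ht), ← Complex.coe_smul, ← Complex.coe_smul, smul_smul,
        ← sub_smul]
    have hψm : MemLp ψ 2 (Q.edgeMeasure e) := by
      refine MemLp.sub ?_ (memLp_of_continuousOn (l := l) (by fun_prop) 2)
      exact MemLp.bilinear_of_continuousOn (ContinuousLinearMap.mul ℝ ℂ)
        (B := fun t => (φ t : ℂ)) (by fun_prop) (Q.memLp_potential e z)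
    rw [e1]
    refine (Q.norm_integral_smul_le hψm (memLp_of_continuousOn hg.1.continuousOn 2)).trans ?_
    refine mul_le_mul_of_nonneg_right ?_ (Q.edgeNorm_nonneg e g)
    refine (Q.edgeNorm_le_add (p := |b|) (q := 10 / a) (by positivity) (by positivity)
      (Q.memLp_potential e z) fun t ht => ?_).trans ?_
    · refine (norm_sub_le _ _).trans ?_
      rw [norm_mul, Complex.norm_real, Complex.norm_real, Real.norm_eq_abs, Real.norm_eq_abs]
      exact add_le_add (mul_le_mul_of_nonneg_right ((hb t ht).trans hlb) (norm_nonneg _))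
        ((hb'' t ht).trans (by gcongr))
    · gcongr
      · exact hV e
      · exact h1 e
  constructor
  -- The cubic `t (1 - t / l)²` has `φ(0) = φ(l) = φ'(l) = 0` and `φ'(0) = 1`, so Green's formula
  -- isolates `g 0`.
  · have hφ : ∀ t : ℝ, HasDerivAt (fun t => t - 2 / l * t ^ 2 + 1 / l ^ 2 * t ^ 3)
        (1 - 4 / l * t + 3 / l ^ 2 * t ^ 2) t := fun t => by
      refine (((hasDerivAt_id t).sub ((hasDerivAt_pow 2 t).const_mul (2 / l))).add
        ((hasDerivAt_pow 3 t).const_mul (1 / l ^ 2))).congr_deriv ?_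
      push_cast; ring
    have hφ' : ∀ t : ℝ, HasDerivAt (fun t => 1 - 4 / l * t + 3 / l ^ 2 * t ^ 2)
        (-(4 / l) + 6 / l ^ 2 * t) t := fun t => by
      refine ((((hasDerivAt_id t).const_mul (4 / l)).const_sub 1).add
        ((hasDerivAt_pow 2 t).const_mul (3 / l ^ 2))).congr_deriv ?_
      push_cast; ring
    have hgreen := hg.1.green hl hφ hφ' (by fun_prop)
    have hv1 : l - 2 / l * l ^ 2 + 1 / l ^ 2 * l ^ 3 = 0 := by field_simp; ring
    have hv2 : 1 - 4 / l * l + 3 / l ^ 2 * l ^ 2 = 0 := by field_simp; ring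
    simp only [hv1, hv2] at hgreen
    have h0 : g 0 = ∫ t in (0 : ℝ)..l, ((t - 2 / l * t ^ 2 + 1 / l ^ 2 * t ^ 3) •
        segDeriv l (segDeriv l g) t - (-(4 / l) + 6 / l ^ 2 * t) • g t) := by
      rw [← hgreen]; simp
    rw [h0]
    refine key (fun t => t - 2 / l * t ^ 2 + 1 / l ^ 2 * t ^ 3) (fun t => -(4 / l) + 6 / l ^ 2 * t)
      (by fun_prop) (by fun_prop) (fun t ht => ?_) fun t ht => ?_
    · have h1 : t - 2 / l * t ^ 2 + 1 / l ^ 2 * t ^ 3 = t * (1 - t / l) ^ 2 := by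
        field_simp; ring
      have h2 : 0 ≤ t / l := div_nonneg ht.1 hl.le
      have h3 : t / l ≤ 1 := (div_le_one hl).2 ht.2
      rw [h1, abs_of_nonneg (mul_nonneg ht.1 (sq_nonneg _))]
      calc t * (1 - t / l) ^ 2 ≤ l * 1 :=
            mul_le_mul ht.2 (by nlinarith) (sq_nonneg _) hl.le
        _ = l := mul_one l
    · have h1 : -(4 / l) + 6 / l ^ 2 * t = (-4 + 6 * (t / l)) / l := by
        field_simp
      have h2 : 0 ≤ t / l := div_nonneg ht.1 hl.le
      have h3 : t / l ≤ 1 := (div_le_one hl).2 ht.2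
      rw [h1, abs_div, abs_of_pos hl]
      gcongr
      rw [abs_le]
      constructor <;> linarith
  -- The cubic `t² (t - l) / l²` has `φ(0) = φ'(0) = φ(l) = 0` and `φ'(l) = 1`, so Green's formula
  -- isolates `-g l`; the sign disappears in the norm.
  · have hφ : ∀ t : ℝ, HasDerivAt (fun t => 1 / l ^ 2 * t ^ 3 - 1 / l * t ^ 2)
        (3 / l ^ 2 * t ^ 2 - 2 / l * t) t := fun t => by
      refine (((hasDerivAt_pow 3 t).const_mul (1 / l ^ 2)).sub
        ((hasDerivAt_pow 2 t).const_mul (1 / l))).congr_deriv ?_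
      push_cast; ring
    have hφ' : ∀ t : ℝ, HasDerivAt (fun t => 3 / l ^ 2 * t ^ 2 - 2 / l * t)
        (6 / l ^ 2 * t - 2 / l) t := fun t => by
      refine (((hasDerivAt_pow 2 t).const_mul (3 / l ^ 2)).sub
        ((hasDerivAt_id t).const_mul (2 / l))).congr_deriv ?_
      push_cast; ring
    have hgreen := hg.1.green hl hφ hφ' (by fun_prop)
    have hv1 : 1 / l ^ 2 * l ^ 3 - 1 / l * l ^ 2 = 0 := by field_simp; ring
    have hv2 : 3 / l ^ 2 * l ^ 2 - 2 / l * l = 1 := by field_simp; ring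
    simp only [hv1, hv2] at hgreen
    have h0 : ‖g l‖ = ‖∫ t in (0 : ℝ)..l, ((1 / l ^ 2 * t ^ 3 - 1 / l * t ^ 2) •
        segDeriv l (segDeriv l g) t - (6 / l ^ 2 * t - 2 / l) • g t)‖ := by
      rw [← hgreen]; simp
    rw [h0]
    refine key (fun t => 1 / l ^ 2 * t ^ 3 - 1 / l * t ^ 2) (fun t => 6 / l ^ 2 * t - 2 / l)
      (by fun_prop) (by fun_prop) (fun t ht => ?_) fun t ht => ?_
    · have h1 : 1 / l ^ 2 * t ^ 3 - 1 / l * t ^ 2 = l * (-((t / l) ^ 2 * (1 - t / l))) := by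
        field_simp; ring
      have h2 : 0 ≤ t / l := div_nonneg ht.1 hl.le
      have h3 : t / l ≤ 1 := (div_le_one hl).2 ht.2
      have h4 : (t / l) ^ 2 ≤ 1 := by nlinarith
      rw [h1, abs_mul, abs_of_pos hl, abs_neg,
        abs_of_nonneg (mul_nonneg (sq_nonneg _) (by linarith))]
      calc l * ((t / l) ^ 2 * (1 - t / l)) ≤ l * (1 * 1) := by
            gcongr
            linarith
        _ = l := by ring
    · have h1 : 6 / l ^ 2 * t - 2 / l = (6 * (t / l) - 2) / l := by
        field_simp
      have h2 : 0 ≤ t / l := div_nonneg ht.1 hl.le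
      have h3 : t / l ≤ 1 := (div_le_one hl).2 ht.2
      rw [h1, abs_div, abs_of_pos hl]
      gcongr
      rw [abs_le]
      constructor <;> linarith

/-! ### Fundamental solutions off the Dirichlet spectrum -/

variable {E z : ℂ} {e : Q.Edge}

/-- Off the Dirichlet spectrum, a solution on an edge is determined by its boundary values. -/
lemma hillSolution_eqOn (hE : E ∉ Q.dirichletOp.unboundedSpectrum)
    (hz : z = E + (Q.kR : ℂ) ^ 2) {g h : ℝ → Spinor}
    (hg : IsHillSolution (Q.len e) (Q.potential e z) g)
    (hh : IsHillSolution (Q.len e) (Q.potential e z) h) (h0 : g 0 = h 0)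
    (hl : g (Q.len e) = h (Q.len e)) : EqOn g h (Icc 0 (Q.len e)) := by
  obtain ⟨C, -, hC⟩ := Q.exists_solution_bound hE hz
  have hd := hg.add (Q.len_pos e) (hh.smul (Q.len_pos e) (-1))
  have h1 := hC e _ hd
  have h2 : Q.edgeNorm e (g + (-1 : ℂ) • h) = 0 := by
    refine le_antisymm (h1.trans ?_) (Q.edgeNorm_nonneg e _)
    simp [h0, hl]
  intro t ht
  have h3 := Q.eqOn_zero_of_edgeNorm_eq_zero hd.1.continuousOn h2 ht
  simpa [← sub_eq_add_neg, sub_eq_zero] using h3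

lemma isScalarSolution_iff {y : ℝ → ℂ} : Q.IsScalarSolution e z y ↔
    IsHillSolution (Q.len e) (Q.potential e z) y := by
  refine and_congr_right fun _ => Filter.eventually_congr (Filter.Eventually.of_forall fun t => ?_)
  simp only [potential, smul_eq_mul]
  constructor <;> intro h <;> linear_combination -h

lemma exists_isScalarSolution (e : Q.Edge) (z p q : ℂ) :
    ∃ y, Q.IsScalarSolution e z y ∧ y 0 = p ∧ segDeriv (Q.len e) y 0 = q := by
  obtain ⟨y, h1, h2, h3, h4⟩ :=
    exists_memH2_initialValue (Q.len_pos e) (Q.memLp_potential e z) p q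
  exact ⟨y, Q.isScalarSolution_iff.2 ⟨h1, h4⟩, h2, h3⟩

/-- `s` is picked by `Classical.epsilon`, so its defining property rests on existence for the
initial value problem. -/
lemma isSineSolution_s (e : Q.Edge) (z : ℂ) : Q.IsSineSolution e z (Q.s e z) :=
  Classical.epsilon_spec (Q.exists_isScalarSolution e z 0 1)

lemma isCosineSolution_c (e : Q.Edge) (z : ℂ) : Q.IsCosineSolution e z (Q.c e z) :=
  Classical.epsilon_spec (Q.exists_isScalarSolution e z 1 0)

lemma isHillSolution_s (e : Q.Edge) (z : ℂ) :
    IsHillSolution (Q.len e) (Q.potential e z) (Q.s e z) :=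
  Q.isScalarSolution_iff.1 (Q.isSineSolution_s e z).1

lemma isHillSolution_c (e : Q.Edge) (z : ℂ) :
    IsHillSolution (Q.len e) (Q.potential e z) (Q.c e z) :=
  Q.isScalarSolution_iff.1 (Q.isCosineSolution_c e z).1

/-- Otherwise `s v`, for a nonzero spinor `v`, would have zero end values and vanish identically,
contradicting `s'(0) = 1`. -/
lemma s_len_ne_zero (hE : E ∉ Q.dirichletOp.unboundedSpectrum)
    (hz : z = E + (Q.kR : ℂ) ^ 2) (e : Q.Edge) : Q.s e z (Q.len e) ≠ 0 := by
  intro h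
  obtain ⟨v, hv⟩ := exists_ne (0 : Spinor)
  have h1 := (Q.isHillSolution_s e z).smul_const (Q.len_pos e) v
  have h2 := (Q.isHillSolution_s e z).smul_const (Q.len_pos e) (0 : Spinor)
  have h3 := Q.hillSolution_eqOn hE hz h1 h2 (by simp [(Q.isSineSolution_s e z).2.1]) (by simp [h])
  have h4 : EqOn (Q.s e z) 0 (Icc 0 (Q.len e)) := fun t ht => by
    simpa [hv] using h3 ht
  have h5 := segDeriv_congr h4 (Q.left_mem e)
  rw [(Q.isSineSolution_s e z).2.2] at h5
  have h6 : segDeriv (Q.len e) (0 : ℝ → ℂ) 0 = 0 := by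
    exact congrFun (derivWithin_const (s := Icc 0 (Q.len e)) (c := (0 : ℂ))) 0
  rw [h6] at h5
  exact one_ne_zero h5

/-- The Wronskian is constant and equals 1 at the left end. This is what eliminates `c'(l)` from the
vertex condition. -/
lemma wronskian_s_c (e : Q.Edge) (z : ℂ) :
    Q.c e z (Q.len e) * Q.s' e z (Q.len e) -
      Q.s e z (Q.len e) * segDeriv (Q.len e) (Q.c e z) (Q.len e) = 1 := by
  have h := wronskian_eq (Q.len_pos e) (Q.isHillSolution_c e z).1 (Q.isHillSolution_s e z).1
    (Q.isHillSolution_c e z).2 (Q.isHillSolution_s e z).2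
  rw [(Q.isSineSolution_s e z).2.1, (Q.isSineSolution_s e z).2.2, (Q.isCosineSolution_c e z).2.1]
    at h
  rw [s', h]
  simp

/-- The gauge transform of a continuous solution solves the Schrödinger equation on each edge. -/
lemma IsContinuousSolution.isHillSolution {Q : RashbaNetwork} {E z : ℂ}
    (hz : z = E + (Q.kR : ℂ) ^ 2) {f : Q.Edge → ℝ → Spinor} {ξ : Q.Vertex → Spinor}
    (hf : Q.IsContinuousSolution E f ξ) (e : Q.Edge) :
    IsHillSolution (Q.len e) (Q.potential e z) (fun t => star (Q.Θ e t) (f e t)) := by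
  have h1 := Q.memH2_star_Θ (hf.memH2 e)
  have h2 : (fun t => Q.Θ e t (star (Q.Θ e t) (f e t))) = f e :=
    funext fun t => Q.Θ_star_apply e t (f e t)
  have h3 := Q.edgeOp_Θ h1
  rw [h2] at h3
  refine ⟨h1, ?_⟩
  filter_upwards [h3, hf.equation e] with t h4 h5
  rw [h4] at h5
  -- Applying `Θ*` to the differential equation strips the unitary factor and leaves `(U - k_R²) g -
  -- g'' = E g`.
  have h6 := congrArg (fun v => star (Q.Θ e t) v) h5
  rw [star_Θ_apply, map_smul, sub_eq_iff_eq_add] at h6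
  rw [← sub_eq_iff_eq_add'.2 h6, potential, hz]
  push_cast
  module

end RashbaNetwork

/-! ### Summation over the graph -/

/-- Each `h k` is counted at most `N` times, so the partial sums stay below `N ∑ h`. It passes sums
between edges and vertices in both directions. -/
lemma summable_comp_of_card_fiber_le {ι κ : Type*} {h : κ → ℝ} (h0 : ∀ k, 0 ≤ h k)
    (hs : Summable h) (π : ι → κ) (N : ℕ)
    (hN : ∀ (k : κ) (S : Finset ι), (∀ i ∈ S, π i = k) → S.card ≤ N) :
    Summable fun i => h (π i) := by
  classical
  refine summable_of_sum_le (c := N * ∑' k, h k) (fun i => h0 (π i)) fun S => ?_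
  rw [Finset.sum_comp h π]
  calc ∑ k ∈ S.image π, (S.filter fun i => π i = k).card • h k
      ≤ ∑ k ∈ S.image π, N * h k := by
        refine Finset.sum_le_sum fun k _ => ?_
        rw [nsmul_eq_mul]
        have := hN k (S.filter fun i => π i = k) fun i hi => (Finset.mem_filter.1 hi).2
        exact mul_le_mul_of_nonneg_right (by exact_mod_cast this) (h0 k)
    _ = N * ∑ k ∈ S.image π, h k := by rw [Finset.mul_sum]
    _ ≤ N * ∑' k, h k := by
        gcongr
        exact hs.sum_le_tsum _ fun k _ => h0 k

lemma memℓp_two_iff {ι : Type*} {E : ι → Type*} [∀ i, NormedAddCommGroup (E i)] {f : ∀ i, E i} :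
    Memℓp f 2 ↔ Summable fun i => ‖f i‖ ^ 2 := by
  rw [memℓp_gen_iff (by norm_num)]
  simp

namespace RashbaNetwork

variable {Q : RashbaNetwork}

/-- Each component is continuous on a compact segment, hence in `L²`; only summability of the
squared norms over the edges is at stake. -/
lemma squareIntegrable_iff {f : Q.Edge → ℝ → Spinor} (hf : ∀ e, MemH2 (Q.len e) (f e)) :
    Q.SquareIntegrable f ↔ Summable fun e => Q.edgeNorm e (f e) ^ 2 := by
  have hm : ∀ e, MemLp (f e) 2 (Q.edgeMeasure e) := fun e =>
    memLp_of_continuousOn (hf e).continuousOn 2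
  constructor
  · rintro ⟨u, hu⟩
    refine (memℓp_two_iff.1 (lp.memℓp u)).congr fun e => ?_
    rw [Lp.norm_def, edgeNorm, eLpNorm_congr_ae (hu e)]
  · intro h
    have h1 : Memℓp (fun e => (hm e).toLp (f e)) 2 := by
      refine memℓp_two_iff.2 (h.congr fun e => ?_)
      rw [Lp.norm_toLp, edgeNorm]
    exact ⟨⟨_, h1⟩, fun e => (hm e).coeFn_toLp⟩

lemma exists_card_fiber_le (Q : RashbaNetwork) : ∃ N : ℕ, ∀ α : Q.Vertex,
    (∀ S : Finset Q.Edge, (∀ e ∈ S, Q.src e = α) → S.card ≤ N) ∧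
    ∀ S : Finset Q.Edge, (∀ e ∈ S, Q.tgt e = α) → S.card ≤ N := by
  obtain ⟨N, hN⟩ := Q.degree_bounds
  have aux : ∀ (T : Set (Space3 × Space3)), T.encard ≤ N → ∀ S : Finset Q.Edge,
      (∀ e ∈ S, e.1 ∈ T) → S.card ≤ N := fun T hT S hS => by
    have h1 : ((S.map (Function.Embedding.subtype _) : Finset (Space3 × Space3)) :
        Set (Space3 × Space3)) ⊆ T := by
      intro x hx
      simp only [Finset.coe_map, mem_image] at hx
      obtain ⟨e, he, rfl⟩ := hx
      exact hS e he
    have h2 := (encard_le_encard h1).trans hT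
    rw [encard_coe_eq_coe_finsetCard, Finset.card_map] at h2
    exact_mod_cast h2
  refine ⟨N, fun α => ⟨fun S hS => ?_, fun S hS => ?_⟩⟩
  · exact aux {e ∈ Q.edges | e.1 = α.1} (le_self_add.trans (hN α.1 α.2).2) S
      fun e he => ⟨e.2, congrArg Subtype.val (hS e he)⟩
  · exact aux {e ∈ Q.edges | e.2 = α.1} (le_add_self.trans (hN α.1 α.2).2) S
      fun e he => ⟨e.2, congrArg Subtype.val (hS e he)⟩

/-- The lower degree bound: without incident edges the total degree would be 0. -/
lemma exists_incident_edge (α : Q.Vertex) : ∃ e, Q.src e = α ∨ Q.tgt e = α := by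
  obtain ⟨N, hN⟩ := Q.degree_bounds
  have h := (hN α.1 α.2).1
  by_contra! hne
  have h1 : {e ∈ Q.edges | e.1 = α.1} = ∅ := eq_empty_of_forall_notMem fun e he =>
    (hne ⟨e, he.1⟩).1 (Subtype.ext he.2)
  have h2 : {e ∈ Q.edges | e.2 = α.1} = ∅ := eq_empty_of_forall_notMem fun e he =>
    (hne ⟨e, he.1⟩).2 (Subtype.ext he.2)
  rw [h1, h2] at h
  simp at h

/-! ### Continuous solutions and their vertex values -/

namespace IsContinuousSolution

variable {E z : ℂ} {f : Q.Edge → ℝ → Spinor} {ξ : Q.Vertex → Spinor}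

lemma gauge_zero (hf : Q.IsContinuousSolution E f ξ) (e : Q.Edge) :
    star (Q.Θ e 0) (f e 0) = ξ (Q.src e) := by
  have h := Q.star_Θ_apply e 0 (f e 0)
  rw [Θ_zero, one_apply_eq_self] at h
  rw [Θ_zero, h, (hf.vertexValues e).1]

lemma gauge_len (hf : Q.IsContinuousSolution E f ξ) (e : Q.Edge) :
    star (Q.Θ e (Q.len e)) (f e (Q.len e)) = star (Q.τ e) (ξ (Q.tgt e)) := by
  rw [(hf.vertexValues e).2, τ]

/-- The gauge transform of a continuous solution in terms of the fundamental solutions. -/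
lemma gauge_eqOn (hE : E ∉ Q.dirichletOp.unboundedSpectrum) (hz : z = E + (Q.kR : ℂ) ^ 2)
    (hf : Q.IsContinuousSolution E f ξ) (e : Q.Edge) :
    EqOn (fun t => star (Q.Θ e t) (f e t))
      (fun t => Q.s e z t • ((Q.s e z (Q.len e))⁻¹ •
        (star (Q.τ e) (ξ (Q.tgt e)) - Q.c e z (Q.len e) • ξ (Q.src e))) +
          Q.c e z t • ξ (Q.src e)) (Icc 0 (Q.len e)) := by
  have hs0 := Q.s_len_ne_zero hE hz e
  -- Both sides solve the same equation, so comparing end values suffices; the coefficient of `s` is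
  -- chosen to match the value at `l`.
  refine Q.hillSolution_eqOn hE hz (hf.isHillSolution hz e)
    (((Q.isHillSolution_s e z).smul_const (Q.len_pos e) _).add (Q.len_pos e)
      ((Q.isHillSolution_c e z).smul_const (Q.len_pos e) _)) ?_ ?_
  · simp only [hf.gauge_zero e, (Q.isSineSolution_s e z).2.1, (Q.isCosineSolution_c e z).2.1]
    simp
  · simp only [hf.gauge_len e]
    rw [smul_smul, mul_inv_cancel₀ hs0, one_smul, sub_add_cancel]

lemma apply_eq (hE : E ∉ Q.dirichletOp.unboundedSpectrum) (hz : z = E + (Q.kR : ℂ) ^ 2)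
    (hf : Q.IsContinuousSolution E f ξ) (e : Q.Edge) {t : ℝ} (ht : t ∈ Icc 0 (Q.len e)) :
    f e t = (Q.s e z t / Q.s e z (Q.len e)) •
        Q.Θ e t (star (Q.τ e) (ξ (Q.tgt e)) - Q.c e z (Q.len e) • ξ (Q.src e)) +
      Q.Θ e t (Q.c e z t • ξ (Q.src e)) := by
  have h := congrArg (fun v => Q.Θ e t v) (hf.gauge_eqOn hE hz e ht)
  simp only [Θ_star_apply] at h
  rw [h, map_add, smul_smul, map_smul, div_eq_mul_inv]

/-- The covariant derivative of `Θ g` is `Θ g'`, and `g` is known explicitly from `gauge_eqOn`. -/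
lemma covDeriv_eq (hE : E ∉ Q.dirichletOp.unboundedSpectrum) (hz : z = E + (Q.kR : ℂ) ^ 2)
    (hf : Q.IsContinuousSolution E f ξ) (e : Q.Edge) {t : ℝ} (ht : t ∈ Icc 0 (Q.len e)) :
    Q.covDeriv e (f e) t = Q.Θ e t (segDeriv (Q.len e) (Q.s e z) t • ((Q.s e z (Q.len e))⁻¹ •
        (star (Q.τ e) (ξ (Q.tgt e)) - Q.c e z (Q.len e) • ξ (Q.src e))) +
          segDeriv (Q.len e) (Q.c e z) t • ξ (Q.src e)) := by
  have h1 := Q.covDeriv_Θ (hf.isHillSolution hz e).1 ht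
  have h2 : (fun t => Q.Θ e t (star (Q.Θ e t) (f e t))) = f e :=
    funext fun t => Q.Θ_star_apply e t (f e t)
  rw [h2] at h1
  rw [h1, segDeriv_congr (hf.gauge_eqOn hE hz e) ht]
  congr 1
  exact segDeriv_eq (Q.len_pos e) ht
    ((((Q.isHillSolution_s e z).1.hasDerivWithinAt ht).smul_const _).add
      (((Q.isHillSolution_c e z).1.hasDerivWithinAt ht).smul_const _))

lemma covDeriv_zero (hE : E ∉ Q.dirichletOp.unboundedSpectrum) (hz : z = E + (Q.kR : ℂ) ^ 2)
    (hf : Q.IsContinuousSolution E f ξ) (e : Q.Edge) :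
    Q.covDeriv e (f e) 0 = (1 / Q.s e z (Q.len e)) • star (Q.τ e) (ξ (Q.tgt e)) -
      (Q.c e z (Q.len e) / Q.s e z (Q.len e)) • ξ (Q.src e) := by
  rw [hf.covDeriv_eq hE hz e (Q.left_mem e), Θ_zero, (Q.isSineSolution_s e z).2.2,
    (Q.isCosineSolution_c e z).2.2, one_apply_eq_self, div_eq_mul_inv, div_eq_mul_inv]
  module

lemma covDeriv_len (hE : E ∉ Q.dirichletOp.unboundedSpectrum) (hz : z = E + (Q.kR : ℂ) ^ 2)
    (hf : Q.IsContinuousSolution E f ξ) (e : Q.Edge) :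
    Q.covDeriv e (f e) (Q.len e) = (Q.s' e z (Q.len e) / Q.s e z (Q.len e)) • ξ (Q.tgt e) -
      (1 / Q.s e z (Q.len e)) • Q.τ e (ξ (Q.src e)) := by
  have hs0 := Q.s_len_ne_zero hE hz e
  have hw := Q.wronskian_s_c e z
  rw [hf.covDeriv_eq hE hz e (Q.right_mem e), ← τ, ← s']
  -- The Wronskian identity solved for `c'(l)`; the coefficient of `τ ξ` at the source then
  -- collapses to `-1 / s(l)`.
  have h1 : segDeriv (Q.len e) (Q.c e z) (Q.len e) =
      (Q.s e z (Q.len e))⁻¹ * (Q.c e z (Q.len e) * Q.s' e z (Q.len e) - 1) := by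
    rw [← hw]
    field_simp
    ring
  have h2 : Q.τ e (star (Q.τ e) (ξ (Q.tgt e))) = ξ (Q.tgt e) := Q.Θ_star_apply e _ _
  rw [h1]
  simp only [map_add, map_smul, map_sub, h2, div_eq_mul_inv]
  module

lemma flux_eq_iff (hE : E ∉ Q.dirichletOp.unboundedSpectrum) (hz : z = E + (Q.kR : ℂ) ^ 2)
    (hf : Q.IsContinuousSolution E f ξ) (α : Q.Vertex) :
    Q.flux f α = (Q.ε α : ℂ) • ξ α ↔
      (∑ᶠ e ∈ Q.outEdges α, (1 / Q.s e z (Q.len e)) • star (Q.τ e) (ξ (Q.tgt e))) +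
          ∑ᶠ e ∈ Q.inEdges α, (1 / Q.s e z (Q.len e)) • Q.τ e (ξ (Q.src e)) =
        ((∑ᶠ e ∈ Q.outEdges α, Q.c e z (Q.len e) / Q.s e z (Q.len e)) +
          (∑ᶠ e ∈ Q.inEdges α, Q.s' e z (Q.len e) / Q.s e z (Q.len e)) +
          (Q.ε α : ℂ)) • ξ α := by
  have ho := Q.finite_outEdges α
  have hi := Q.finite_inEdges α
  have h1 : ∑ᶠ e ∈ Q.outEdges α, Q.covDeriv e (f e) 0 =
      (∑ᶠ e ∈ Q.outEdges α, (1 / Q.s e z (Q.len e)) • star (Q.τ e) (ξ (Q.tgt e))) -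
        (∑ᶠ e ∈ Q.outEdges α, Q.c e z (Q.len e) / Q.s e z (Q.len e)) • ξ α := by
    simp only [finsum_mem_eq_finite_toFinset_sum _ ho, Finset.sum_smul, ← Finset.sum_sub_distrib]
    refine Finset.sum_congr rfl fun e he => ?_
    have : Q.src e = α := (ho.mem_toFinset).1 he
    rw [hf.covDeriv_zero hE hz e, this]
  have h2 : ∑ᶠ e ∈ Q.inEdges α, Q.covDeriv e (f e) (Q.len e) =
      (∑ᶠ e ∈ Q.inEdges α, Q.s' e z (Q.len e) / Q.s e z (Q.len e)) • ξ α -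
        ∑ᶠ e ∈ Q.inEdges α, (1 / Q.s e z (Q.len e)) • Q.τ e (ξ (Q.src e)) := by
    simp only [finsum_mem_eq_finite_toFinset_sum _ hi, Finset.sum_smul, ← Finset.sum_sub_distrib]
    refine Finset.sum_congr rfl fun e he => ?_
    have : Q.tgt e = α := (hi.mem_toFinset).1 he
    rw [hf.covDeriv_len hE hz e, this]
  -- Moved to one side, both equations equate the same expression to zero.
  rw [flux, h1, h2, add_smul, add_smul, ← sub_eq_zero, ← sub_eq_zero (b := _ + _ + _)]
  refine Eq.congr_left ?_
  abel

/-- The `L²` norm on an edge and the two end values bound each other with constants independent of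
the edge. The spectral assumption is needed only from vertex values to `f`; the other direction is
Green's formula. -/
lemma squareIntegrable_iff_memℓp (hE : E ∉ Q.dirichletOp.unboundedSpectrum)
    (hz : z = E + (Q.kR : ℂ) ^ 2) (hf : Q.IsContinuousSolution E f ξ) :
    Q.SquareIntegrable f ↔ Memℓp ξ 2 := by
  have hn : ∀ e, Q.edgeNorm e (fun t => star (Q.Θ e t) (f e t)) = Q.edgeNorm e (f e) := fun e =>
    Q.edgeNorm_congr_norm fun t _ => Q.norm_star_Θ_apply e t _
  have hn0 : ∀ e, ‖star (Q.Θ e 0) (f e 0)‖ = ‖ξ (Q.src e)‖ := fun e => by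
    rw [hf.gauge_zero e]
  have hnl : ∀ e, ‖star (Q.Θ e (Q.len e)) (f e (Q.len e))‖ = ‖ξ (Q.tgt e)‖ := fun e => by
    rw [norm_star_Θ_apply, (hf.vertexValues e).2]
  rw [squareIntegrable_iff hf.memH2, memℓp_two_iff]
  constructor
  · intro h
    obtain ⟨C, hC, hB⟩ := Q.exists_boundary_bound z
    choose π hπ using exists_incident_edge (Q := Q)
    have hsum : Summable fun α => Q.edgeNorm (π α) (f (π α)) ^ 2 := by
      classical
      -- `π α` is a chosen edge at `α`. The constant 2 appears because an edge can be chosen only by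
      -- its two ends.
      refine summable_comp_of_card_fiber_le (h := fun e => Q.edgeNorm e (f e) ^ 2)
        (fun e => sq_nonneg _) h π 2 fun e S hS => ?_
      refine (Finset.card_le_card (t := {Q.src e, Q.tgt e}) fun α hα => ?_).trans
        Finset.card_le_two
      have := hπ α
      rw [hS α hα] at this
      rw [Finset.mem_insert, Finset.mem_singleton]
      exact this.imp Eq.symm Eq.symm
    refine Summable.of_nonneg_of_le (fun α => sq_nonneg _) (fun α => ?_) (hsum.mul_left (C ^ 2))
    have h1 := hB (π α) _ (hf.isHillSolution hz (π α))
    rw [hn, hn0, hnl] at h1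
    rw [← mul_pow]
    refine pow_le_pow_left₀ (norm_nonneg _) ?_ 2
    rcases hπ α with h2 | h2
    · rw [h2] at h1
      exact h1.1
    · rw [h2] at h1
      exact h1.2
  · intro h
    obtain ⟨C, hC, hB⟩ := Q.exists_solution_bound hE hz
    obtain ⟨N, hN⟩ := Q.exists_card_fiber_le
    have h1 := summable_comp_of_card_fiber_le (fun α => sq_nonneg ‖ξ α‖) h Q.src N
      fun α => (hN α).1
    have h2 := summable_comp_of_card_fiber_le (fun α => sq_nonneg ‖ξ α‖) h Q.tgt N
      fun α => (hN α).2
    refine Summable.of_nonneg_of_le (fun e => sq_nonneg _) (fun e => ?_)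
      ((h1.add h2).mul_left (2 * C ^ 2))
    have h3 := hB e _ (hf.isHillSolution hz e)
    rw [hn, hn0, hnl] at h3
    calc Q.edgeNorm e (f e) ^ 2 ≤ (C * (‖ξ (Q.src e)‖ + ‖ξ (Q.tgt e)‖)) ^ 2 :=
          pow_le_pow_left₀ (Q.edgeNorm_nonneg e _) h3 2
      _ = C ^ 2 * (‖ξ (Q.src e)‖ + ‖ξ (Q.tgt e)‖) ^ 2 := mul_pow _ _ _
      _ ≤ C ^ 2 * (2 * (‖ξ (Q.src e)‖ ^ 2 + ‖ξ (Q.tgt e)‖ ^ 2)) := by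
          gcongr
          exact add_sq_le
      _ = _ := by ring

/-- A square integrable solution has image `E f`, again square integrable, so it lies in the domain
of the maximal operator automatically. It is nonzero as a state because representatives continuous
on the segment are unique there. -/
lemma isEigenfunction_iff (hf : Q.IsContinuousSolution E f ξ)
    (hflux : ∀ α, Q.flux f α = (Q.ε α : ℂ) • ξ α)
    (hne : ∃ e, ∃ t ∈ Icc 0 (Q.len e), f e t ≠ 0) :
    Q.IsEigenfunction E f ↔ Q.SquareIntegrable f := by
  constructor
  · rintro ⟨u, -, hu, -⟩
    exact ⟨u, hu⟩
  · rintro ⟨u, hu⟩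
    have hgraph : (u, E • u) ∈ Q.maximalGraph :=
      ⟨f, hf.memH2, hu, fun e => ((hu.smul E) e).trans
        (Filter.EventuallyEq.symm (hf.equation e))⟩
    rw [← graph_maximalOp, LinearPMap.mem_graph_iff] at hgraph
    obtain ⟨y, hy1, hy2⟩ := hgraph
    simp only at hy1 hy2
    have hdom : u ∈ Q.hamiltonianDomain := ⟨f, ξ, hf.memH2, hu, hf.vertexValues, hflux⟩
    let x : Q.hamiltonian.domain := ⟨u, hdom, hy1 ▸ y.2⟩
    have hxy : Q.hamiltonian x = Q.maximalOp y := LinearPMap.domRestrict_apply hy1.symm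
    refine ⟨x, fun h0 => ?_, hu, hxy.trans hy2⟩
    obtain ⟨e, t, ht, hft⟩ := hne
    have hu0 : u = 0 := h0
    rw [hu0] at hu
    exact hft (Q.eqOn_of_represents hf.memH2 (fun _ => MemH2.zero) hu Q.represents_zero e ht)

end IsContinuousSolution

end RashbaNetwork

end

theorem mainTheorem9 (Q : RashbaNetwork) (E : ℂ) (hE : E ∉ Q.dirichletOp.unboundedSpectrum)
    (z : ℂ) (hz : z = E + (Q.kR : ℂ) ^ 2) :
    (∀ e : Q.Edge, Q.IsSineSolution e z (Q.s e z) ∧ Q.IsCosineSolution e z (Q.c e z) ∧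
      Q.s e z (Q.len e) ≠ 0) ∧
    ∀ (f : Q.Edge → ℝ → Spinor) (ξ : Q.Vertex → Spinor), Q.IsContinuousSolution E f ξ →
      (∀ e : Q.Edge, ∀ t ∈ Set.Icc 0 (Q.len e),
        f e t = (Q.s e z t / Q.s e z (Q.len e)) •
            Q.Θ e t (star (Q.τ e) (ξ (Q.tgt e)) - Q.c e z (Q.len e) • ξ (Q.src e)) +
          Q.Θ e t (Q.c e z t • ξ (Q.src e))) ∧
      (∀ α : Q.Vertex, Q.flux f α = (Q.ε α : ℂ) • ξ α ↔
        (∑ᶠ e ∈ Q.outEdges α, (1 / Q.s e z (Q.len e)) • star (Q.τ e) (ξ (Q.tgt e))) +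
            ∑ᶠ e ∈ Q.inEdges α, (1 / Q.s e z (Q.len e)) • Q.τ e (ξ (Q.src e)) =
          ((∑ᶠ e ∈ Q.outEdges α, Q.c e z (Q.len e) / Q.s e z (Q.len e)) +
            (∑ᶠ e ∈ Q.inEdges α, Q.s' e z (Q.len e) / Q.s e z (Q.len e)) +
            (Q.ε α : ℂ)) • ξ α) ∧
      (Q.SquareIntegrable f ↔ Memℓp ξ 2) ∧
      ((∀ α : Q.Vertex, Q.flux f α = (Q.ε α : ℂ) • ξ α) →
        (∃ e : Q.Edge, ∃ t ∈ Set.Icc 0 (Q.len e), f e t ≠ 0) →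
        (Q.IsEigenfunction E f ↔ Memℓp ξ 2)) :=
  ⟨fun e => ⟨Q.isSineSolution_s e z, Q.isCosineSolution_c e z, Q.s_len_ne_zero hE hz e⟩,
    fun _ _ hf => ⟨fun e _ ht => hf.apply_eq hE hz e ht, fun α => hf.flux_eq_iff hE hz α,
      hf.squareIntegrable_iff_memℓp hE hz, fun hflux hne =>
        (hf.isEigenfunction_iff hflux hne).trans (hf.squareIntegrable_iff_memℓp hE hz)⟩⟩
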